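/- **Conventions.** A locally compact groupoid $G$ is a topological groupoid in which every arrow has a compact Hausdorff neighbourhood and whose space of units $G^{0}$ is Hausdorff; $r,s$ are its range and source maps, and $\gamma\eta$ is defined when $s(\gamma)=r(\eta)$. For a locally compact, possibly non-Hausdorff space $T$, $C_c(T)$ is the linear span of the functions that are continuous with compact support on an open Hausdorff subset of $T$ and $0$ elsewhere (the usual $C_c(T)$ if $T$ is Hausdorff). A continuous family of measures along a map $\pi\colon T\to B$ is a family $(\lambda_b)_{b\in B}$ of Radon measures, $\lambda_b$ living on $\pi^{-1}(b)$, such that $b\mapsto\int f\,d\lambda_b$ is continuous for every $f\in C_c(T)$; it has full support if $\operatorname{supp}\lambda_b=\pi^{-1}(b)$ for all $b$. A Haar system on $G$ is a left invariant continuous family of measures $\chi=(\chi^v)_{v\in G^0}$ of full support along $r$. An action of $G$ on a right $G$-space $X$ with momentum map $s_X$ is proper if $(x,\gamma)\mapsto(x,x\gamma)$, $X\times_{G^0}G\to X\times X$, is a proper map. A topological correspondence from $(G,\chi)$ to $(H,\kappa)$ (locally compact groupoids with Haar systems) is a locally compact $G$-$H$-bispace $X$, with momentum maps $r_X\colon X\to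 G^0$ and $s_X\colon X\to H^0$ and proper $H$-action, together with an $H$-invariant continuous family of measures $\lambda$ of full support along $s_X$, for which there is a continuous function $\Delta\colon G\ltimes X\to(0,\infty)$, the adjoining function, such that for all $u\in H^0$ and $F\in C_c(G\times_{G^0}X)$ $$\int_{X_u}\int_{G^{r_X(x)}}F(\gamma^{-1},x)\,d\chi^{r_X(x)}(\gamma)\,d\lambda_u(x)=\int_{X_u}\int_{G^{r_X(x)}}F(\gamma,\gamma^{-1}x)\,\Delta(\gamma,\gamma^{-1}x)\,d\chi^{r_X(x)}(\gamma)\,d\lambda_u(x).$$ For a groupoid $G$ with a family of measures $\chi$ along $r$ and a measure $m$ on $G^0$, let $(m\circ\chi)(f)=\int\int f(\gamma)\,d\chi^v(\gamma)\,dm(v)$ and $(m\circ\chi^{-1})(f)=\int\int f(\gamma^{-1})\,d\chi^v(\gamma)\,dm(v)$ for $f\in C_c(G)$. The measure $m$ is invariant if $m\circ\chi=m\circ\chi^{-1}$. It is strongly quasi-invariant with cocycle $\Delta$ if $\Delta\colon G\to(0,\infty)$ is a continuous homomorphism and $m\circ\chi=\Delta\cdot(m\circ\chi^{-1})$. **Lemma.**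 Let $(G_i,\chi_i)$, $i=1,2,3$, be locally compact groupoids with Haar systems, let $(X,\alpha)$ and $(Y,\beta)$ be topological correspondences from $(G_1,\chi_1)$ to $(G_2,\chi_2)$ and from $(G_2,\chi_2)$ to $(G_3,\chi_3)$, with $X$ and $Y$ Hausdorff, and let $\Delta_2$ be the adjoining function of $(Y,\beta)$. Let $Z=X\times_{G_2^0}Y=\{(x,y): s_X(x)=r_Y(y)\}$ with the diagonal right action $(x,y)\gamma=(x\gamma,\gamma^{-1}y)$ of $G_2$, and let $\Omega=Z/G_2$. Assume that $X$ and $Y$ are second countable or, more generally, that $\Omega$ is paracompact. Let $Z\rtimes G_2$ be the transformation groupoid, with $r((x,y),\gamma)=(x,y)$ and $s((x,y),\gamma)=(x\gamma,\gamma^{-1}y)$, and let $\chi$ be the family of measures on it given by $\int f\,d\chi^{(x,y)}=\int f((x,y),\gamma)\,d\chi_2^{s_X(x)}(\gamma)$. Let $u\in G_3^0$. Then there is exactly one Radon measure $m_u=\alpha\times\beta_u$ on $Z$ with $$\int_Z f\,dm_u=\int_{Y_u}\int_{X_{r_Y(y)}}f(x,y)\,d\alpha_{r_Y(y)}(x)\,d\beta_u(y)\qquad\text{for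 all }f\in C_c(Z),$$ and: 1. $m_u$ is strongly quasi-invariant with respect to $(Z\rtimes G_2,\chi)$, with cocycle $\Delta((x,y),\gamma)=\Delta_2(\gamma^{-1},y)$; 2. there is a continuous function $b\colon Z\to(0,\infty)$ such that the measure $b\,m_u$ is invariant with respect to $(Z\rtimes G_2,\chi)$ and $$\frac{b(x\gamma,\gamma^{-1}y)}{b(x,y)}=\Delta_2(\gamma^{-1},y)\qquad\text{for all }((x,y),\gamma)\in Z\rtimes G_2.$$ -/

import Mathlib

open MeasureTheory Topology

/-! ### Fibre products, test functions, families of measures -/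

/-- The fibre product `X ×_B Y` of two maps `f : X → B` and `g : Y → B`, with the subspace
topology of `X × Y` and its Borel σ-algebra. -/
def FibreProduct {X Y B : Type*} (f : X → B) (g : Y → B) : Type _ :=
  {p : X × Y // f p.1 = g p.2}

namespace FibreProduct

variable {X Y B : Type*} {f : X → B} {g : Y → B}

/-- The point `(x, y)` of the fibre product. -/
def mk (x : X) (y : Y) (h : f x = g y) : FibreProduct f g := ⟨(x, y), h⟩

/-- First coordinate. -/
def fst (p : FibreProduct f g) : X := p.1.1

/-- Second coordinate. -/
def snd (p : FibreProduct f g) : Y := p.1.2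

theorem w (p : FibreProduct f g) : f p.fst = g p.snd := p.2

theorem ext' {p q : FibreProduct f g} (h₁ : p.fst = q.fst) (h₂ : p.snd = q.snd) : p = q :=
  Subtype.ext (Prod.ext h₁ h₂)

instance [TopologicalSpace X] [TopologicalSpace Y] : TopologicalSpace (FibreProduct f g) :=
  inferInstanceAs (TopologicalSpace {p : X × Y // f p.1 = g p.2})

instance [TopologicalSpace X] [TopologicalSpace Y] : MeasurableSpace (FibreProduct f g) :=
  borel _

instance [TopologicalSpace X] [TopologicalSpace Y] : BorelSpace (FibreProduct f g) := ⟨rfl⟩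

theorem continuous_fst [TopologicalSpace X] [TopologicalSpace Y] :
    Continuous (fst : FibreProduct f g → X) :=
  _root_.continuous_fst.comp continuous_subtype_val

theorem continuous_snd [TopologicalSpace X] [TopologicalSpace Y] :
    Continuous (snd : FibreProduct f g → Y) :=
  _root_.continuous_snd.comp continuous_subtype_val

theorem continuous_mk [TopologicalSpace X] [TopologicalSpace Y] {T : Type*} [TopologicalSpace T]
    {a : T → X} {b : T → Y} (ha : Continuous a) (hb : Continuous b) (h : ∀ t, f (a t) = g (b t)) :
    Continuous fun t => (mk (a t) (b t) (h t) : FibreProduct f g) :=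
  (ha.prodMk hb).subtype_mk h

end FibreProduct

/-- Local compactness for spaces that need not be Hausdorff: every point has a compact Hausdorff
neighbourhood. -/
def LocallyCompactLocallyT2 (X : Type*) [TopologicalSpace X] : Prop :=
  ∀ x : X, ∃ K ∈ 𝓝 x, IsCompact K ∧ T2Space K

/-- `C_c(X)` for a locally compact, not necessarily Hausdorff space `X`: the linear span of the
functions that are continuous with compact support on some open Hausdorff subset and vanish
elsewhere. On a Hausdorff space these are the continuous functions of compact support, see
`mem_Cc_iff`. -/
def Cc (X : Type*) [TopologicalSpace X] : Submodule ℝ (X → ℝ) :=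
  Submodule.span ℝ {f | ∃ U : Set X, IsOpen U ∧ T2Space U ∧ ContinuousOn f U ∧
    ∃ K ⊆ U, IsCompact K ∧ ∀ x ∉ K, f x = 0}

theorem mem_Cc_iff {X : Type*} [TopologicalSpace X] [T2Space X] (f : X → ℝ) :
    f ∈ Cc X ↔ Continuous f ∧ HasCompactSupport f := by
  constructor
  · intro hf
    induction hf using Submodule.span_induction with
    | mem f hf =>
      obtain ⟨U, hU, -, hfU, K, hKU, hK, h0⟩ := hf
      refine ⟨?_, HasCompactSupport.intro hK h0⟩
      rw [continuous_iff_continuousAt]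
      intro x
      by_cases hx : x ∈ K
      · exact hfU.continuousAt (hU.mem_nhds (hKU hx))
      · have : f =ᶠ[𝓝 x] fun _ => 0 := by
          filter_upwards [hK.isClosed.isOpen_compl.mem_nhds hx] with y hy using h0 y hy
        exact continuousAt_const.congr this.symm
    | zero => exact ⟨continuous_const, HasCompactSupport.zero⟩
    | add f g _ _ hf hg => exact ⟨hf.1.add hg.1, hf.2.add hg.2⟩
    | smul a f _ hf => exact ⟨hf.1.const_smul a, hf.2.smul_left (f := fun _ => a)⟩
  · rintro ⟨hf, hc⟩
    exact Submodule.subset_span ⟨Set.univ, isOpen_univ, inferInstance, hf.continuousOn,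
      tsupport f, Set.subset_univ _, hc, fun x hx => image_eq_zero_of_notMem_tsupport hx⟩

/-- A continuous family of Radon measures along `π : X → B`: the measure `lam b` lives on the fibre
over `b`, and `b ↦ ∫ f d(lam b)` is continuous for each `f` in `C_c(X)`. -/
structure IsContinuousFamily {X B : Type*} [TopologicalSpace X] [MeasurableSpace X]
    [TopologicalSpace B] (π : X → B) (lam : ∀ b, Measure {x : X // π x = b}) : Prop where
  regular : ∀ b, (lam b).Regular
  continuous_integral : ∀ f ∈ Cc X, Continuous fun b => ∫ x, f x.1 ∂(lam b)

/-- Each measure of the family has full support in its fibre. -/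
def HasFullSupport {X B : Type*} [TopologicalSpace X] [MeasurableSpace X]
    (π : X → B) (lam : ∀ b, Measure {x : X // π x = b}) : Prop :=
  ∀ b, (lam b).IsOpenPosMeasure

/-! ### Topological groupoids, Haar systems, actions -/

/-- A topological groupoid with space of units `B` and space of arrows `G`; the product `g h` is
defined when `s g = r h`. -/
structure TopGroupoid (B G : Type*) [TopologicalSpace B] [TopologicalSpace G] where
  r : G → B
  s : G → B
  unit : B → G
  inv : G → G
  mul : ∀ g h : G, s g = r h → G
  r_unit : ∀ b, r (unit b) = b
  s_unit : ∀ b, s (unit b) = b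
  r_inv : ∀ g, r (inv g) = s g
  s_inv : ∀ g, s (inv g) = r g
  r_mul : ∀ g h e, r (mul g h e) = r g
  s_mul : ∀ g h e, s (mul g h e) = s h
  unit_mul : ∀ g, mul (unit (r g)) g (s_unit _) = g
  mul_unit : ∀ g, mul g (unit (s g)) (r_unit _).symm = g
  inv_mul : ∀ g, mul (inv g) g (s_inv g) = unit (s g)
  mul_inv : ∀ g, mul g (inv g) (r_inv g).symm = unit (r g)
  mul_assoc : ∀ g h k (e : s g = r h) (e' : s h = r k),
    mul (mul g h e) k ((s_mul g h e).trans e') = mul g (mul h k e') (e.trans (r_mul h k e').symm)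
  continuous_r : Continuous r
  continuous_s : Continuous s
  continuous_unit : Continuous unit
  continuous_inv : Continuous inv
  continuous_mul : Continuous fun p : FibreProduct s r => mul p.fst p.snd p.w

/-- A locally compact groupoid: the space of arrows is locally compact (possibly non-Hausdorff) and
the space of units is Hausdorff. -/
structure TopGroupoid.IsLocallyCompact {B G : Type*} [TopologicalSpace B] [TopologicalSpace G]
    (𝓖 : TopGroupoid B G) : Prop where
  locallyCompact : LocallyCompactLocallyT2 G
  t2_units : T2Space B

/-- A Haar system: a left invariant continuous family of Radon measures of full support along the
range map. -/
structure HaarSystem {B G : Type*} [TopologicalSpace B] [TopologicalSpace G] [MeasurableSpace G]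
    (𝓖 : TopGroupoid B G) where
  measure : ∀ b : B, Measure {g : G // 𝓖.r g = b}
  continuousFamily : IsContinuousFamily 𝓖.r measure
  fullSupport : HasFullSupport 𝓖.r measure
  left_invariant : ∀ g : G,
    (measure (𝓖.s g)).map (fun h => ⟨𝓖.mul g h.1 h.2.symm, 𝓖.r_mul _ _ _⟩) = measure (𝓖.r g)

/-- A continuous left action of a groupoid on `X` with momentum map `mom`. -/
structure LeftAction {B G : Type*} [TopologicalSpace B] [TopologicalSpace G]
    (𝓖 : TopGroupoid B G) (X : Type*) [TopologicalSpace X] where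
  mom : X → B
  act : ∀ (g : G) (x : X), 𝓖.s g = mom x → X
  mom_act : ∀ g x e, mom (act g x e) = 𝓖.r g
  unit_act : ∀ x, act (𝓖.unit (mom x)) x (𝓖.s_unit _) = x
  mul_act : ∀ g h x (e : 𝓖.s g = 𝓖.r h) (e' : 𝓖.s h = mom x),
    act (𝓖.mul g h e) x ((𝓖.s_mul g h e).trans e') = act g (act h x e') (e.trans (mom_act h x e').symm)
  continuous_mom : Continuous mom
  continuous_act : Continuous fun p : FibreProduct 𝓖.s mom => act p.fst p.snd p.w

/-- A continuous right action of a groupoid on `X` with momentum map `mom`. -/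
structure RightAction {B G : Type*} [TopologicalSpace B] [TopologicalSpace G]
    (𝓖 : TopGroupoid B G) (X : Type*) [TopologicalSpace X] where
  mom : X → B
  act : ∀ (x : X) (g : G), mom x = 𝓖.r g → X
  mom_act : ∀ x g e, mom (act x g e) = 𝓖.s g
  act_unit : ∀ x, act x (𝓖.unit (mom x)) (𝓖.r_unit _).symm = x
  act_mul : ∀ x g h (e : mom x = 𝓖.r g) (e' : 𝓖.s g = 𝓖.r h),
    act x (𝓖.mul g h e') (e.trans (𝓖.r_mul g h e').symm) = act (act x g e) h ((mom_act x g e).trans e')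
  continuous_mom : Continuous mom
  continuous_act : Continuous fun p : FibreProduct mom 𝓖.r => act p.fst p.snd p.w

section Actions

variable {B G X Y : Type*} [TopologicalSpace B] [TopologicalSpace G]
  [TopologicalSpace X] [TopologicalSpace Y] {𝓖 : TopGroupoid B G}

theorem LeftAction.act_congr (L : LeftAction 𝓖 X) {g g' : G} {x x' : X} (hg : g = g') (hx : x = x')
    (e : 𝓖.s g = L.mom x) (e' : 𝓖.s g' = L.mom x') : L.act g x e = L.act g' x' e' := by
  subst hg hx; rfl

theorem RightAction.act_congr (R : RightAction 𝓖 X) {g g' : G} {x x' : X} (hx : x = x')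
    (hg : g = g') (e : R.mom x = 𝓖.r g) (e' : R.mom x' = 𝓖.r g') :
    R.act x g e = R.act x' g' e' := by
  subst hg hx; rfl

theorem TopGroupoid.mul_congr (𝓖 : TopGroupoid B G) {g g' h h' : G} (hg : g = g') (hh : h = h')
    (e : 𝓖.s g = 𝓖.r h) (e' : 𝓖.s g' = 𝓖.r h') : 𝓖.mul g h e = 𝓖.mul g' h' e' := by
  subst hg hh; rfl

theorem TopGroupoid.inv_eq (𝓖 : TopGroupoid B G) {g h : G} (e : 𝓖.s h = 𝓖.r g)
    (hu : 𝓖.mul h g e = 𝓖.unit (𝓖.s g)) : h = 𝓖.inv g := by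
  have h1 := 𝓖.mul_assoc h g (𝓖.inv g) e (𝓖.r_inv g).symm
  have h2 : 𝓖.mul h (𝓖.mul g (𝓖.inv g) (𝓖.r_inv g).symm)
      (e.trans (𝓖.r_mul _ _ _).symm) = h := by
    rw [𝓖.mul_congr rfl (𝓖.mul_inv g) _ (e.trans (𝓖.r_unit _).symm)]
    rw [𝓖.mul_congr rfl (congrArg 𝓖.unit e.symm) _ (𝓖.r_unit _).symm]
    exact 𝓖.mul_unit h
  have h3 : 𝓖.mul (𝓖.mul h g e) (𝓖.inv g) ((𝓖.s_mul h g e).trans (𝓖.r_inv g).symm) = 𝓖.inv g := by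
    rw [𝓖.mul_congr (hu.trans (congrArg 𝓖.unit (𝓖.r_inv g).symm)) rfl _ (𝓖.s_unit _)]
    exact 𝓖.unit_mul _
  rw [← h2, ← h1, h3]

theorem TopGroupoid.inv_unit (𝓖 : TopGroupoid B G) (b : B) : 𝓖.inv (𝓖.unit b) = 𝓖.unit b := by
  symm
  refine 𝓖.inv_eq ((𝓖.s_unit b).trans (𝓖.r_unit b).symm) ?_
  have := 𝓖.mul_unit (𝓖.unit b)
  rw [𝓖.mul_congr rfl (congrArg 𝓖.unit (𝓖.s_unit b)) _
    ((𝓖.s_unit b).trans (𝓖.r_unit b).symm)] at this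
  rw [this, 𝓖.s_unit]

theorem TopGroupoid.inv_mul_rev (𝓖 : TopGroupoid B G) (g h : G) (e : 𝓖.s g = 𝓖.r h) :
    𝓖.inv (𝓖.mul g h e) =
      𝓖.mul (𝓖.inv h) (𝓖.inv g) (((𝓖.s_inv h).trans e.symm).trans (𝓖.r_inv g).symm) := by
  symm
  refine 𝓖.inv_eq (((𝓖.s_mul _ _ _).trans (𝓖.s_inv g)).trans (𝓖.r_mul _ _ _).symm) ?_
  rw [𝓖.mul_assoc (𝓖.inv h) (𝓖.inv g) (𝓖.mul g h e) _ ((𝓖.s_inv g).trans (𝓖.r_mul _ _ _).symm)]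
  have h1 : 𝓖.mul (𝓖.inv g) (𝓖.mul g h e) ((𝓖.s_inv g).trans (𝓖.r_mul _ _ _).symm) = h := by
    rw [← 𝓖.mul_assoc (𝓖.inv g) g h (𝓖.s_inv g) e]
    rw [𝓖.mul_congr ((𝓖.inv_mul g).trans (congrArg 𝓖.unit e)) rfl _ (𝓖.s_unit _)]
    exact 𝓖.unit_mul h
  rw [𝓖.mul_congr rfl h1 _ (𝓖.s_inv h), 𝓖.inv_mul, 𝓖.s_mul]

/-- The diagonal right action `(x, y) γ = (x γ, γ⁻¹ y)` on the fibre product of a right and a left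
space. -/
def diagonalAction (R : RightAction 𝓖 X) (L : LeftAction 𝓖 Y) :
    RightAction 𝓖 (FibreProduct R.mom L.mom) where
  mom z := R.mom z.fst
  act z g e := FibreProduct.mk (R.act z.fst g e)
    (L.act (𝓖.inv g) z.snd (((𝓖.s_inv g).trans e.symm).trans z.w))
    ((R.mom_act _ _ _).trans ((L.mom_act _ _ _).trans (𝓖.r_inv g)).symm)
  mom_act z g e := R.mom_act _ _ _
  act_unit z := by
    refine FibreProduct.ext' (R.act_unit _) ?_
    refine (L.act_congr ?_ rfl _ (𝓖.s_unit _)).trans (L.unit_act z.snd)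
    rw [𝓖.inv_unit, z.w]
  act_mul z g h e e' := by
    refine FibreProduct.ext' (R.act_mul _ _ _ _ _) ?_
    refine (L.act_congr (𝓖.inv_mul_rev g h e') rfl _
      ((𝓖.s_mul _ _ _).trans (((𝓖.s_inv g).trans e.symm).trans z.w))).trans ?_
    exact L.mul_act _ _ _ _ _
  continuous_mom := R.continuous_mom.comp FibreProduct.continuous_fst
  continuous_act := by
    refine FibreProduct.continuous_mk ?_ ?_ _
    · exact R.continuous_act.comp (FibreProduct.continuous_mk
        (FibreProduct.continuous_fst.comp FibreProduct.continuous_fst) FibreProduct.continuous_snd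
        fun p => p.w)
    · exact L.continuous_act.comp (FibreProduct.continuous_mk
        (𝓖.continuous_inv.comp FibreProduct.continuous_snd)
        (FibreProduct.continuous_snd.comp FibreProduct.continuous_fst)
        fun p => ((𝓖.s_inv p.snd).trans p.w.symm).trans p.fst.w)

/-- The transformation groupoid `X ⋊ G`, with `r (x, g) = x`, `s (x, g) = x g`,
`(x, g) (x g, h) = (x, g h)` and `(x, g)⁻¹ = (x g, g⁻¹)`. -/
def RightAction.transformation (R : RightAction 𝓖 X) :
    TopGroupoid X (FibreProduct R.mom 𝓖.r) where
  r p := p.fst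
  s p := R.act p.fst p.snd p.w
  unit x := FibreProduct.mk x (𝓖.unit (R.mom x)) (𝓖.r_unit _).symm
  inv p := FibreProduct.mk (R.act p.fst p.snd p.w) (𝓖.inv p.snd)
    ((R.mom_act _ _ _).trans (𝓖.r_inv _).symm)
  mul p q e := FibreProduct.mk p.fst
    (𝓖.mul p.snd q.snd ((R.mom_act p.fst p.snd p.w).symm.trans ((congrArg R.mom e).trans q.w)))
    (p.w.trans (𝓖.r_mul _ _ _).symm)
  r_unit _ := rfl
  s_unit x := R.act_unit x
  r_inv _ := rfl
  s_inv p := by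
    refine (R.act_mul p.fst p.snd (𝓖.inv p.snd) p.w (𝓖.r_inv _).symm).symm.trans ?_
    refine (R.act_congr rfl ((𝓖.mul_inv p.snd).trans (congrArg 𝓖.unit p.w.symm)) _
      (𝓖.r_unit _).symm).trans (R.act_unit _)
  r_mul _ _ _ := rfl
  s_mul p q e := by
    refine (R.act_mul p.fst p.snd q.snd p.w
      ((R.mom_act p.fst p.snd p.w).symm.trans ((congrArg R.mom e).trans q.w))).trans ?_
    exact R.act_congr e rfl _ _
  unit_mul p := by
    refine FibreProduct.ext' rfl ?_
    exact (𝓖.mul_congr (congrArg 𝓖.unit p.w) rfl _ (𝓖.s_unit _)).trans (𝓖.unit_mul p.snd)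
  mul_unit p := by
    refine FibreProduct.ext' rfl ?_
    exact (𝓖.mul_congr rfl (congrArg 𝓖.unit (R.mom_act p.fst p.snd p.w)) _
      (𝓖.r_unit _).symm).trans (𝓖.mul_unit p.snd)
  inv_mul p := by
    refine FibreProduct.ext' rfl ?_
    exact (𝓖.inv_mul p.snd).trans (congrArg 𝓖.unit (R.mom_act p.fst p.snd p.w).symm)
  mul_inv p := by
    refine FibreProduct.ext' rfl ?_
    exact (𝓖.mul_inv p.snd).trans (congrArg 𝓖.unit p.w.symm)
  mul_assoc p q k e e' := FibreProduct.ext' rfl (𝓖.mul_assoc _ _ _ _ _)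
  continuous_r := FibreProduct.continuous_fst
  continuous_s := R.continuous_act
  continuous_unit :=
    FibreProduct.continuous_mk continuous_id (𝓖.continuous_unit.comp R.continuous_mom) _
  continuous_inv :=
    FibreProduct.continuous_mk R.continuous_act
      (𝓖.continuous_inv.comp FibreProduct.continuous_snd) _
  continuous_mul := by
    refine FibreProduct.continuous_mk
      (FibreProduct.continuous_fst.comp FibreProduct.continuous_fst) ?_ _
    exact 𝓖.continuous_mul.comp (FibreProduct.continuous_mk
      (FibreProduct.continuous_snd.comp FibreProduct.continuous_fst)
      (FibreProduct.continuous_snd.comp FibreProduct.continuous_snd)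
      fun p => (R.mom_act p.fst.fst p.fst.snd p.fst.w).symm.trans
        ((congrArg R.mom p.w).trans p.snd.w))

/-- The Haar system that `chi` induces on `X ⋊ G`:
`∫ f dχ^x = ∫ f (x, γ) dχ^{mom x}(γ)`. -/
noncomputable def RightAction.inducedHaar [MeasurableSpace G] (R : RightAction 𝓖 X)
    (chi : HaarSystem 𝓖) (x : X) :
    Measure {p : FibreProduct R.mom 𝓖.r // R.transformation.r p = x} :=
  (chi.measure (R.mom x)).map fun g => ⟨FibreProduct.mk x g.1 g.2.symm, rfl⟩

/-- The orbit space `X / G`, with the quotient topology. -/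
abbrev RightAction.OrbitSpace (R : RightAction 𝓖 X) : Type _ :=
  Quot fun x x' : X => ∃ (g : G) (e : R.mom x = 𝓖.r g), R.act x g e = x'

/-- The action is proper: `(x, g) ↦ (x, x g)` is a proper map from `X ×_B G` to `X × X`. -/
def RightAction.IsProper (R : RightAction 𝓖 X) : Prop :=
  IsProperMap fun p : FibreProduct R.mom 𝓖.r => (p.fst, R.act p.fst p.snd p.w)

end Actions

/-! ### Invariant and strongly quasi-invariant measures -/

section QuasiInvariance

variable {B G : Type*} [TopologicalSpace B] [TopologicalSpace G] [MeasurableSpace B]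
  [MeasurableSpace G]

/-- The measure `m` on the units is invariant: `m ∘ lam = m ∘ lam⁻¹` as functionals on `C_c(G)`. -/
def TopGroupoid.IsInvariantMeasure (𝓖 : TopGroupoid B G)
    (lam : ∀ b, Measure {g : G // 𝓖.r g = b}) (m : Measure B) : Prop :=
  ∀ f ∈ Cc G, ∫ b, ∫ g, f g.1 ∂(lam b) ∂m = ∫ b, ∫ g, f (𝓖.inv g.1) ∂(lam b) ∂m

/-- The measure `m` on the units is strongly quasi-invariant and `Δ` implements this: `Δ` is a
continuous homomorphism to the multiplicative group of positive reals (a 1-cocycle) and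
`m ∘ lam = Δ · (m ∘ lam⁻¹)` as functionals on `C_c(G)`. -/
structure TopGroupoid.IsStronglyQuasiInvariant (𝓖 : TopGroupoid B G)
    (lam : ∀ b, Measure {g : G // 𝓖.r g = b}) (m : Measure B) (Δ : G → ℝ) : Prop where
  continuous : Continuous Δ
  pos : ∀ g, 0 < Δ g
  map_mul : ∀ g h (e : 𝓖.s g = 𝓖.r h), Δ (𝓖.mul g h e) = Δ g * Δ h
  quasiInvariant : ∀ f ∈ Cc G, ∫ b, ∫ g, f g.1 ∂(lam b) ∂m =
    ∫ b, ∫ g, f (𝓖.inv g.1) * Δ (𝓖.inv g.1) ∂(lam b) ∂m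

end QuasiInvariance

/-! ### Topological correspondences -/

/-- A topological correspondence `(X, lam)` from `(G, chi)` to `(H, kappa)`, together with its
adjoining function `adj` (which is determined by the other data). -/
structure TopCorrespondence {B G C H : Type*} [TopologicalSpace B] [TopologicalSpace G]
    [TopologicalSpace C] [TopologicalSpace H] [MeasurableSpace G] [MeasurableSpace H]
    {𝓖 : TopGroupoid B G} {𝓗 : TopGroupoid C H} (chi : HaarSystem 𝓖) (_kappa : HaarSystem 𝓗)
    (X : Type*) [TopologicalSpace X] [MeasurableSpace X] where
  locallyCompact : LocallyCompactLocallyT2 X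
  left : LeftAction 𝓖 X
  right : RightAction 𝓗 X
  right_mom_left : ∀ g x e, right.mom (left.act g x e) = right.mom x
  left_mom_right : ∀ x h e, left.mom (right.act x h e) = left.mom x
  act_comm : ∀ g x h (e : 𝓖.s g = left.mom x) (e' : right.mom x = 𝓗.r h),
    right.act (left.act g x e) h ((right_mom_left g x e).trans e') =
      left.act g (right.act x h e') (e.trans (left_mom_right x h e').symm)
  proper : right.IsProper
  lam : ∀ c : C, Measure {x : X // right.mom x = c}
  continuousFamily : IsContinuousFamily right.mom lam
  fullSupport : HasFullSupport right.mom lam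
  invariant : ∀ h : H, (lam (𝓗.r h)).map (fun x => ⟨right.act x.1 h x.2, right.mom_act _ _ _⟩) =
    lam (𝓗.s h)
  adj : FibreProduct 𝓖.s left.mom → ℝ
  adj_continuous : Continuous adj
  adj_pos : ∀ p, 0 < adj p
  adj_spec : ∀ (c : C), ∀ F ∈ Cc (FibreProduct 𝓖.s left.mom),
    ∫ x, ∫ g, F (FibreProduct.mk (𝓖.inv g.1) x.1 ((𝓖.s_inv g.1).trans g.2))
        ∂(chi.measure (left.mom x.1)) ∂(lam c) =
      ∫ x, ∫ g, (fun p => F p * adj p) (FibreProduct.mk g.1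
          (left.act (𝓖.inv g.1) x.1 ((𝓖.s_inv g.1).trans g.2))
          ((left.mom_act _ _ _).trans (𝓖.r_inv g.1)).symm)
        ∂(chi.measure (left.mom x.1)) ∂(lam c)

section Composite

variable {B₁ G₁ B₂ G₂ B₃ G₃ X Y : Type*}
  [TopologicalSpace B₁] [TopologicalSpace G₁] [TopologicalSpace B₂] [TopologicalSpace G₂]
  [TopologicalSpace B₃] [TopologicalSpace G₃] [TopologicalSpace X] [TopologicalSpace Y]
  [MeasurableSpace G₁] [MeasurableSpace G₂] [MeasurableSpace G₃]
  [MeasurableSpace X] [MeasurableSpace Y]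
  {𝓖₁ : TopGroupoid B₁ G₁} {𝓖₂ : TopGroupoid B₂ G₂} {𝓖₃ : TopGroupoid B₃ G₃}
  {chi₁ : HaarSystem 𝓖₁} {chi₂ : HaarSystem 𝓖₂} {chi₃ : HaarSystem 𝓖₃}

/-- The space `Z = X ×_{G₂⁰} Y`. -/
abbrev CompositeSpace (P : TopCorrespondence chi₁ chi₂ X) (Q : TopCorrespondence chi₂ chi₃ Y) :
    Type _ :=
  FibreProduct P.right.mom Q.left.mom

/-- The diagonal action of `G₂` on `Z`. -/
abbrev compositeAction (P : TopCorrespondence chi₁ chi₂ X) (Q : TopCorrespondence chi₂ chi₃ Y) :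
    RightAction 𝓖₂ (CompositeSpace P Q) :=
  diagonalAction P.right Q.left

/-- `m` is the Radon measure `α × β_u` on `Z`, that is,
`∫ f dm = ∫_Y ∫_X f(x, y) dα_{r_Y(y)}(x) dβ_u(y)` for `f` in `C_c(Z)`. -/
structure IsCompositeMeasure (P : TopCorrespondence chi₁ chi₂ X)
    (Q : TopCorrespondence chi₂ chi₃ Y) (u : B₃) (m : Measure (CompositeSpace P Q)) : Prop where
  regular : m.Regular
  integral_eq : ∀ f ∈ Cc (CompositeSpace P Q), ∫ z, f z ∂m =
    ∫ y, ∫ x, f (FibreProduct.mk x.1 y.1 x.2) ∂(P.lam (Q.left.mom y.1)) ∂(Q.lam u)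

/-- The function `Δ((x, y), γ) = Δ₂(γ⁻¹, y)` on `Z ⋊ G₂`. -/
def compositeCocycle (P : TopCorrespondence chi₁ chi₂ X) (Q : TopCorrespondence chi₂ chi₃ Y)
    (p : FibreProduct (compositeAction P Q).mom 𝓖₂.r) : ℝ :=
  Q.adj (FibreProduct.mk (𝓖₂.inv p.snd) p.fst.snd
    (((𝓖₂.s_inv p.snd).trans p.w.symm).trans p.fst.w))

end Composite

/-!
The measure `m_u` is given by the Riesz representation theorem. For this, and throughout, one needs
that integrating out one variable of a fibre product maps `C_c(S ×_B T)` to `C_c(S)`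
(`mem_Cc_integral_fiber`). The arrow space of `G₂` need not be Hausdorff, so elements of `C_c` are
not always continuous; by `mem_span_of_cover` they are sums of functions supported in products of
open Hausdorff sets, where Tietze's theorem and a uniformity argument apply. The fibres of the range
map are nevertheless Hausdorff (`TopGroupoid.t2Space_fiber`), which gives Fubini's theorem on them.

Quasi-invariance of `m_u` (`IsCompositeMeasure.isStronglyQuasiInvariant`): integrate a test function
on `Z ⋊ G₂` over `X` first. The result is a test function on `Y ⋊ G₂`, to which the adjoining relation
of `Y` applies; since the measures on `X` are invariant under `G₂`, this is the inversion of `Z ⋊ G₂`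
with density `Δ₂`.

That `Δ₂` is multiplicative (`TopCorrespondence.adj_mul`) is not part of the definition of a
correspondence. On the 2-simplices `(y, g, h)` of `Y ⋊ G₂`, with the measure obtained by integrating
over `h`, `g` and `y`, exchanging `g` and `h` preserves the measure, and the map
`(y, g, h) ↦ (g⁻¹ y, g⁻¹, g⁻¹ h)` transforms it by the density `Δ₂(g, g⁻¹ y)`. These two involutions
satisfy the braid relation. Comparing the densities of its two sides, integrated against test
functions, gives the cocycle identity, by continuity and full support.

The function `b` (`TopGroupoid.exists_density`) exists because `Z ⋊ G₂` is a proper groupoid with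
paracompact Hausdorff orbit space, so its continuous cocycles are coboundaries. The usual construction
integrates `e(zγ) / Δ(z, γ)` over `γ` for a cutoff function `e`; the result can be discontinuous if
`Z ⋊ G₂` is not Hausdorff. The supremum over `γ` transforms in the same way and is always continuous,
because the range map is open and the groupoid is proper. Local solutions are glued by a partition of
unity on the orbit space. Finally, a quasi-invariant measure times a function that transforms by its
cocycle is invariant (`TopGroupoid.IsStronglyQuasiInvariant.isInvariantMeasure`).
-/

/-! ### Test functions on locally Hausdorff spaces -/

/-- Every point has an open Hausdorff neighbourhood. Together with `LocallyCompactSpace` this is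
`LocallyCompactLocallyT2`, in a form that passes to fibre products. -/
def LocallyT2 (T : Type*) [TopologicalSpace T] : Prop :=
  ∀ x : T, ∃ U : Set T, IsOpen U ∧ x ∈ U ∧ T2Space U

section LocallyT2

variable {T : Type*} [TopologicalSpace T]

theorem LocallyT2.of_t2Space [T2Space T] : LocallyT2 T := fun _ =>
  ⟨Set.univ, isOpen_univ, Set.mem_univ _, inferInstance⟩

theorem LocallyCompactLocallyT2.locallyT2 (h : LocallyCompactLocallyT2 T) : LocallyT2 T := by
  intro x
  obtain ⟨K, hK, -, hT⟩ := h x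
  exact ⟨interior K, isOpen_interior, mem_interior_iff_mem_nhds.2 hK,
    (IsEmbedding.inclusion interior_subset).t2Space⟩

theorem LocallyCompactLocallyT2.locallyCompactSpace (h : LocallyCompactLocallyT2 T) :
    LocallyCompactSpace T := by
  constructor
  intro x n hn
  obtain ⟨K, hK, hKc, hT⟩ := h x
  have : CompactSpace K := isCompact_iff_compactSpace.1 hKc
  have hx : x ∈ K := mem_of_mem_nhds hK
  obtain ⟨s, hs, hsn, hsc⟩ := LocallyCompactSpace.local_compact_nhds (⟨x, hx⟩ : K)
    (Subtype.val ⁻¹' n) (continuous_subtype_val.continuousAt.preimage_mem_nhds hn)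
  refine ⟨Subtype.val '' s, ?_, Set.image_subset_iff.2 hsn, hsc.image continuous_subtype_val⟩
  rw [← map_nhds_subtype_coe_eq_nhds hx hK]
  exact Filter.image_mem_map hs

theorem LocallyT2.t1Space (h : LocallyT2 T) : T1Space T := by
  refine ⟨fun y => isOpen_compl_iff.1 (isOpen_iff_mem_nhds.2 fun x hx => ?_)⟩
  obtain ⟨U, hU, hxU, hT⟩ := h x
  have h1 : {z : U | z.1 ≠ y} ∈ 𝓝 (⟨x, hxU⟩ : U) := by
    by_cases hy : y ∈ U
    · have : IsOpen ({⟨y, hy⟩}ᶜ : Set U) := isOpen_compl_singleton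
      refine Filter.mem_of_superset (this.mem_nhds fun e => hx (congrArg Subtype.val e)) ?_
      intro z hz e
      exact hz (Subtype.ext e)
    · exact Filter.univ_mem' fun z e => hy (e ▸ z.2)
  have h2 := Filter.image_mem_map (m := Subtype.val) h1
  rw [map_nhds_subtype_coe_eq_nhds hxU (hU.mem_nhds hxU)] at h2
  refine Filter.mem_of_superset h2 ?_
  rintro _ ⟨z, hz, rfl⟩
  exact hz

end LocallyT2

/-- `f` is continuous on `U` and vanishes outside a compact subset of `U`. For `U` open and Hausdorff
these are the generators of `Cc T`; they need not be continuous on `T`. -/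
def IsTestOn {T : Type*} [TopologicalSpace T] (U : Set T) (f : T → ℝ) : Prop :=
  ContinuousOn f U ∧ ∃ K ⊆ U, IsCompact K ∧ ∀ x ∉ K, f x = 0

/-- Extension by zero of a function on a subset. -/
noncomputable def extendZero {T : Type*} (U : Set T) (g : U → ℝ) (x : T) : ℝ :=
  open Classical in if h : x ∈ U then g ⟨x, h⟩ else 0

theorem extendZero_of_mem {T : Type*} {U : Set T} (g : U → ℝ) {x : T} (h : x ∈ U) :
    extendZero U g x = g ⟨x, h⟩ := dif_pos h

theorem extendZero_coe {T : Type*} {U : Set T} (g : U → ℝ) (x : U) : extendZero U g x = g x :=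
  dif_pos x.2

section Cc

variable {T S : Type*} [TopologicalSpace T] [TopologicalSpace S]

theorem IsTestOn.mem_Cc {U : Set T} (hU : IsOpen U) (hT : T2Space U) {f : T → ℝ}
    (hf : IsTestOn U f) : f ∈ Cc T :=
  Submodule.subset_span ⟨U, hU, hT, hf.1, hf.2⟩

theorem isCompact_preimage_coe {U K : Set T} (hKU : K ⊆ U) (hK : IsCompact K) :
    IsCompact (Subtype.val ⁻¹' K : Set U) := by
  rw [Subtype.isCompact_iff, Subtype.image_preimage_coe, Set.inter_eq_right.2 hKU]
  exact hK

theorem isOpen_diff_of_isCompact {U K : Set T} (hU : IsOpen U) (hT : T2Space U) (hKU : K ⊆ U)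
    (hK : IsCompact K) : IsOpen (U \ K) := by
  have h1 : IsCompact (Subtype.val ⁻¹' K : Set U) :=
    isCompact_preimage_coe hKU hK
  have h2 := hU.isOpenMap_subtype_val _ h1.isClosed.isOpen_compl
  convert h2 using 1
  ext x
  simp

/-- A function that is continuous near a compact set and vanishes off it is continuous on every
open Hausdorff set containing the compact set. -/
theorem ContinuousOn.of_eq_zero_off_compact {U W K : Set T} {f : T → ℝ} (hW : IsOpen W)
    (hfW : ContinuousOn f W) (hKW : K ⊆ W) (hU : IsOpen U) (hT : T2Space U) (hKU : K ⊆ U)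
    (hK : IsCompact K) (h0 : ∀ x ∉ K, f x = 0) : ContinuousOn f U := by
  intro x hx
  apply ContinuousAt.continuousWithinAt
  by_cases hxK : x ∈ K
  · exact hfW.continuousAt (hW.mem_nhds (hKW hxK))
  · refine (continuousAt_const (y := (0 : ℝ))).congr ?_
    filter_upwards [(isOpen_diff_of_isCompact hU hT hKU hK).mem_nhds ⟨hx, hxK⟩] with y hy
    exact (h0 y hy.2).symm

theorem isTestOn_extendZero {U : Set T} {g : U → ℝ} (hg : Continuous g)
    (hc : HasCompactSupport g) : IsTestOn U (extendZero U g) := by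
  refine ⟨?_, Subtype.val '' tsupport g, ?_, hc.image continuous_subtype_val, ?_⟩
  · rw [continuousOn_iff_continuous_domRestrict]
    convert hg using 1
    ext x
    exact extendZero_coe g x
  · rintro _ ⟨x, -, rfl⟩
    exact x.2
  · intro x hx
    by_cases h : x ∈ U
    · rw [extendZero_of_mem g h]
      exact image_eq_zero_of_notMem_tsupport fun h' => hx ⟨_, h', rfl⟩
    · exact dif_neg h

/-- A compact subset of an open Hausdorff set carries a test function that is `1` on it. -/
theorem exists_isTestOn_eq_one [LocallyCompactSpace T] {U K : Set T} (hU : IsOpen U)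
    (hT : T2Space U) (hKU : K ⊆ U) (hK : IsCompact K) :
    ∃ ψ : T → ℝ, IsTestOn U ψ ∧ (∀ x, 0 ≤ ψ x) ∧ ∀ x ∈ K, ψ x = 1 := by
  have : LocallyCompactSpace U := hU.locallyCompactSpace
  have h1 : IsCompact (Subtype.val ⁻¹' K : Set U) :=
    isCompact_preimage_coe hKU hK
  obtain ⟨g, hg1, -, hgc, hg⟩ := exists_continuous_one_zero_of_isCompact h1 isClosed_empty
    (Set.disjoint_empty _)
  refine ⟨extendZero U g, isTestOn_extendZero g.continuous hgc, fun x => ?_, fun x hx => ?_⟩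
  · unfold extendZero
    split_ifs with h
    · exact (hg _).1
    · exact le_rfl
  · rw [extendZero_of_mem _ (hKU hx)]
    exact hg1 hx

/-- Bump functions at a point of a locally compact, locally Hausdorff space. -/
theorem exists_mem_Cc_pos [LocallyCompactSpace T] (hT : LocallyT2 T) {W : Set T} (hW : IsOpen W)
    {x : T} (hx : x ∈ W) :
    ∃ U ⊆ W, IsOpen U ∧ T2Space U ∧ x ∈ U ∧
      ∃ f : T → ℝ, IsTestOn U f ∧ (∀ x, 0 ≤ f x) ∧ f x = 1 := by
  obtain ⟨U, hU, hxU, hUT⟩ := hT x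
  have hT' : T2Space (W ∩ U : Set T) := (IsEmbedding.inclusion Set.inter_subset_right).t2Space
  obtain ⟨f, hf, hf0, hf1⟩ := exists_isTestOn_eq_one (hW.inter hU) hT'
    (Set.singleton_subset_iff.2 ⟨hx, hxU⟩) isCompact_singleton
  exact ⟨W ∩ U, Set.inter_subset_left, hW.inter hU, hT', ⟨hx, hxU⟩, f, hf, hf0, hf1 x rfl⟩

/-- `C_c` is spanned by the functions supported in the members of any given cover by open Hausdorff
sets. -/
theorem mem_span_of_cover [LocallyCompactSpace T] (𝒰 : Set (Set T)) (hopen : ∀ U ∈ 𝒰, IsOpen U)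
    (hT2 : ∀ U ∈ 𝒰, T2Space U) (hcov : ∀ x, ∃ U ∈ 𝒰, x ∈ U) {f : T → ℝ} (hf : f ∈ Cc T) :
    f ∈ Submodule.span ℝ {g | ∃ U ∈ 𝒰, IsTestOn U g} := by
  refine (Submodule.span_le.2 ?_ : Cc T ≤ _) hf
  rintro f ⟨W, hW, hWT, hfW, K, hKW, hK, h0⟩
  have : LocallyCompactSpace W := hW.locallyCompactSpace
  obtain ⟨s, hs, hsf, hKs⟩ := hK.elim_finite_subcover_image (b := 𝒰) (c := id) hopen
    (fun x _ => by
      obtain ⟨U, hU, hx⟩ := hcov x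
      exact Set.mem_biUnion hU hx)
  obtain ⟨n, e, he⟩ := hsf.fin_embedding
  have hemem : ∀ i, e i ∈ 𝒰 := fun i => hs (he ▸ Set.mem_range_self i)
  have h1 : IsCompact (Subtype.val ⁻¹' K : Set W) :=
    isCompact_preimage_coe hKW hK
  -- Partition of unity on `K` in the locally compact Hausdorff space `W`.
  obtain ⟨ρ, hρs, hρ1, -, hρc⟩ := exists_continuous_sum_one_of_isOpen_isCompact
    (X := W) (s := fun i => Subtype.val ⁻¹' (e i))
    (fun i => (hopen _ (hemem i)).preimage continuous_subtype_val) h1 (by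
      intro x hx
      obtain ⟨U, hU, hxU⟩ := Set.mem_iUnion₂.1 (hKs hx)
      rw [← he] at hU
      obtain ⟨i, rfl⟩ := hU
      exact Set.mem_iUnion.2 ⟨i, hxU⟩)
  have hfc : Continuous fun x : W => f x := hfW.domRestrict
  have hsum : f = ∑ i, extendZero W (fun x => ρ i x * f x) := by
    ext x
    rw [Finset.sum_apply]
    by_cases hx : x ∈ W
    · simp_rw [extendZero_of_mem _ hx, ← Finset.sum_mul]
      by_cases hxK : x ∈ K
      · have := hρ1 (show (⟨x, hx⟩ : W) ∈ Subtype.val ⁻¹' K from hxK)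
        rw [Finset.sum_apply] at this
        rw [this]
        simp
      · rw [h0 x hxK, mul_zero]
    · simp only [extendZero, dif_neg hx, Finset.sum_const_zero]
      exact h0 x fun h => hx (hKW h)
  rw [hsum]
  refine Submodule.sum_mem _ fun i _ => Submodule.subset_span ⟨e i, hemem i, ?_⟩
  obtain ⟨hcont, -⟩ := isTestOn_extendZero (((ρ i).continuous.mul hfc)) ((hρc i).mul_right)
  have hsub : Subtype.val '' tsupport (ρ i) ⊆ e i := Set.image_subset_iff.2 (hρs i)
  have hcpt : IsCompact (Subtype.val '' tsupport (ρ i)) := (hρc i).image continuous_subtype_val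
  have hz : ∀ x ∉ Subtype.val '' tsupport (ρ i), extendZero W (fun x => ρ i x * f x) x = 0 := by
    intro x hx
    unfold extendZero
    split_ifs with h
    · change ρ i ⟨x, h⟩ * f x = 0
      rw [image_eq_zero_of_notMem_tsupport fun h' => hx ⟨_, h', rfl⟩, zero_mul]
    · rfl
  -- The pieces are continuous on `W`; being supported in a compact subset of `W ∩ e i`, they are
  -- continuous on `e i` as well.
  refine ⟨?_, _, hsub, hcpt, hz⟩
  refine ContinuousOn.of_eq_zero_off_compact hW hcont ?_ (hopen _ (hemem i)) (hT2 _ (hemem i))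
    hsub hcpt hz
  rintro _ ⟨x, -, rfl⟩
  exact x.2

theorem mem_Cc_comp_isClosedEmbedding {f : T → ℝ} (hf : f ∈ Cc T) {j : S → T}
    (hj : IsClosedEmbedding j) : (fun x => f (j x)) ∈ Cc S := by
  induction hf using Submodule.span_induction with
  | mem f hf =>
    obtain ⟨U, hU, hT, hfU, K, hKU, hK, h0⟩ := hf
    have hT' : T2Space (j ⁻¹' U) :=
      T2Space.of_injective_continuous (f := fun x : j ⁻¹' U => (⟨j x.1, x.2⟩ : U))
        (fun x y h => Subtype.ext (hj.injective (congrArg Subtype.val h)))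
        ((hj.continuous.comp continuous_subtype_val).subtype_mk _)
    exact Submodule.subset_span ⟨j ⁻¹' U, hU.preimage hj.continuous, hT',
      hfU.comp hj.continuous.continuousOn fun x hx => hx, j ⁻¹' K, Set.preimage_mono hKU,
      hj.isCompact_preimage hK, fun x hx => h0 _ hx⟩
  | zero => exact (Cc S).zero_mem
  | add f g _ _ hf hg => exact (Cc S).add_mem hf hg
  | smul a f _ hf => exact (Cc S).smul_mem a hf

theorem mem_Cc_mul_continuous {f : T → ℝ} (hf : f ∈ Cc T) {g : T → ℝ} (hg : Continuous g) :
    (fun x => f x * g x) ∈ Cc T := by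
  induction hf using Submodule.span_induction with
  | mem f hf =>
    obtain ⟨U, hU, hT, hfU, K, hKU, hK, h0⟩ := hf
    exact Submodule.subset_span ⟨U, hU, hT, hfU.mul hg.continuousOn, K, hKU, hK,
      fun x hx => by simp [h0 x hx]⟩
  | zero =>
    convert (Cc T).zero_mem using 1
    ext x
    simp
  | add f f' _ _ hf hf' =>
    convert (Cc T).add_mem hf hf' using 1
    ext x
    simp [add_mul]
  | smul a f _ hf =>
    convert (Cc T).smul_mem a hf using 1
    ext x
    simp [mul_assoc]

/-- Tietze extension for compactly supported functions. -/
theorem exists_continuous_hasCompactSupport_extension [LocallyCompactSpace T] [T2Space T]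
    {e : S → T} (he : IsClosedEmbedding e) {f : S → ℝ} (hf : Continuous f)
    (hc : HasCompactSupport f) :
    ∃ F : T → ℝ, Continuous F ∧ HasCompactSupport F ∧ ∀ x, F (e x) = f x := by
  have hS : IsCompact (e '' tsupport f) := hc.image he.continuous
  -- Extend inside the compact space `L` and cut off by `ψ`, which is supported in the interior of `L`.
  obtain ⟨L, hL, hSL, -⟩ := exists_compact_between hS isOpen_univ (Set.subset_univ _)
  obtain ⟨L', hL', hSL', hLL⟩ := exists_compact_between hS isOpen_interior hSL
  have : CompactSpace L := isCompact_iff_compactSpace.1 hL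
  obtain ⟨ψ, hψ1, hψ0, hψc, -⟩ := exists_continuous_one_zero_of_isCompact hS
    (isOpen_interior (s := L')).isClosed_compl (Set.disjoint_compl_right_iff_subset.2 hSL')
  have hψL : tsupport ψ ⊆ interior L := by
    refine (closure_minimal ?_ hL'.isClosed).trans hLL
    intro x hx
    by_contra h
    exact hx (hψ0 fun h' => h (interior_subset h'))
  have he' : IsClosedEmbedding (fun x : e ⁻¹' L => (⟨e x.1, x.2⟩ : L)) :=
    he.restrictPreimage L
  obtain ⟨g, hg⟩ := ContinuousMap.exists_extension he'
    ⟨fun x => f x.1, hf.comp continuous_subtype_val⟩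
  have hg' : ∀ x (h : e x ∈ L), g ⟨e x, h⟩ = f x := fun x h =>
    congrArg (fun k : C(e ⁻¹' L, ℝ) => k ⟨x, h⟩) hg
  refine ⟨fun t => ψ t * extendZero L g t, ?_, hψc.mul_right, fun x => ?_⟩
  · rw [continuous_iff_continuousAt]
    intro t
    by_cases ht : t ∈ tsupport ψ
    · have hn : L ∈ 𝓝 t := mem_interior_iff_mem_nhds.1 (hψL ht)
      refine ψ.continuous.continuousAt.mul (ContinuousOn.continuousAt ?_ hn)
      rw [continuousOn_iff_continuous_domRestrict]
      convert g.continuous using 1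
      ext x
      exact extendZero_coe g x
    · refine (continuousAt_const (y := (0 : ℝ))).congr ?_
      filter_upwards [(isClosed_tsupport ψ).isOpen_compl.mem_nhds ht] with y hy
      rw [image_eq_zero_of_notMem_tsupport hy, zero_mul]
  · by_cases hx : x ∈ tsupport f
    · have h1 : e x ∈ e '' tsupport f := ⟨x, hx, rfl⟩
      have h2 : e x ∈ L := interior_subset (hSL h1)
      change ψ (e x) * _ = _
      rw [hψ1 h1, extendZero_of_mem _ h2, hg' x h2]
      simp
    · have hfx : f x = 0 := image_eq_zero_of_notMem_tsupport hx
      by_cases h2 : e x ∈ L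
      · change ψ (e x) * _ = _
        rw [extendZero_of_mem _ h2, hg' x h2, hfx, mul_zero]
      · change ψ (e x) * _ = _
        rw [extendZero, dif_neg h2, mul_zero, hfx]

end Cc

/-! ### Fibre products and integration along the fibres -/

section FibreProductTopology

variable {S T B : Type*} [TopologicalSpace S] [TopologicalSpace T] {σ : S → B} {π : T → B}

theorem FibreProduct.isEmbedding_prod :
    IsEmbedding fun p : FibreProduct σ π => (p.fst, p.snd) :=
  IsEmbedding.subtypeVal

theorem FibreProduct.isClosedEmbedding_prod [TopologicalSpace B] [T2Space B] (hσ : Continuous σ)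
    (hπ : Continuous π) :
    IsClosedEmbedding fun p : FibreProduct σ π => (p.fst, p.snd) := by
  have h : IsClosed {p : S × T | σ p.1 = π p.2} :=
    isClosed_eq (hσ.comp _root_.continuous_fst) (hπ.comp _root_.continuous_snd)
  exact h.isClosedEmbedding_subtypeVal

theorem FibreProduct.locallyCompactSpace [TopologicalSpace B] [T2Space B] [LocallyCompactSpace S]
    [LocallyCompactSpace T] (hσ : Continuous σ) (hπ : Continuous π) :
    LocallyCompactSpace (FibreProduct σ π) :=
  (isClosedEmbedding_prod hσ hπ).locallyCompactSpace

theorem FibreProduct.t2Space_preimage {V : Set S} {U : Set T} (hV : T2Space V) (hU : T2Space U) :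
    T2Space ({p | p.fst ∈ V ∧ p.snd ∈ U} : Set (FibreProduct σ π)) := by
  refine T2Space.of_injective_continuous
    (f := fun p : {p : FibreProduct σ π | p.fst ∈ V ∧ p.snd ∈ U} =>
      ((⟨p.1.fst, p.2.1⟩, ⟨p.1.snd, p.2.2⟩) : V × U)) ?_ ?_
  · intro p q h
    exact Subtype.ext (FibreProduct.ext' (congrArg (fun x => x.1.1) h)
      (congrArg (fun x => x.2.1) h))
  · exact ((FibreProduct.continuous_fst.comp continuous_subtype_val).subtype_mk _).prodMk
      ((FibreProduct.continuous_snd.comp continuous_subtype_val).subtype_mk _)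

theorem FibreProduct.isOpen_preimage {V : Set S} {U : Set T} (hV : IsOpen V) (hU : IsOpen U) :
    IsOpen ({p | p.fst ∈ V ∧ p.snd ∈ U} : Set (FibreProduct σ π)) :=
  (hV.preimage FibreProduct.continuous_fst).inter (hU.preimage FibreProduct.continuous_snd)

theorem FibreProduct.locallyT2 (hS : LocallyT2 S) (hT : LocallyT2 T) :
    LocallyT2 (FibreProduct σ π) := by
  intro p
  obtain ⟨V, hV, hpV, hVT⟩ := hS p.fst
  obtain ⟨U, hU, hpU, hUT⟩ := hT p.snd
  exact ⟨_, FibreProduct.isOpen_preimage hV hU, ⟨hpV, hpU⟩,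
    FibreProduct.t2Space_preimage hVT hUT⟩

instance FibreProduct.t2Space [T2Space S] [T2Space T] : T2Space (FibreProduct σ π) :=
  inferInstanceAs (T2Space {p : S × T // σ p.1 = π p.2})

/-- The inclusion of the fibre of `π` over `σ s` into the fibre product, as the points over `s`. -/
theorem FibreProduct.isClosedEmbedding_slice [T1Space S] (s : S) :
    IsClosedEmbedding fun t : {t : T // π t = σ s} =>
      (FibreProduct.mk s t.1 t.2.symm : FibreProduct σ π) := by
  have hc : Continuous fun t : {t : T // π t = σ s} =>
      (FibreProduct.mk s t.1 t.2.symm : FibreProduct σ π) :=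
    FibreProduct.continuous_mk continuous_const continuous_subtype_val _
  refine ⟨IsEmbedding.of_comp hc FibreProduct.continuous_snd IsEmbedding.subtypeVal, ?_⟩
  convert (isClosed_singleton (x := s)).preimage
    (FibreProduct.continuous_fst (f := σ) (g := π)) using 1
  ext p
  constructor
  · rintro ⟨t, rfl⟩
    rfl
  · intro hp
    have hp' : p.fst = s := hp
    exact ⟨⟨p.snd, p.w.symm.trans (congrArg σ hp')⟩, FibreProduct.ext' hp'.symm rfl⟩

end FibreProductTopology

theorem isClosedEmbedding_fiber {T B : Type*} [TopologicalSpace T] [TopologicalSpace B] [T2Space B]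
    {π : T → B} (hπ : Continuous π) (b : B) :
    IsClosedEmbedding (Subtype.val : {t : T // π t = b} → T) :=
  (isClosed_eq hπ continuous_const).isClosedEmbedding_subtypeVal

section Family

variable {S T B : Type*} [TopologicalSpace S] [TopologicalSpace T] [TopologicalSpace B]
  [MeasurableSpace T] [BorelSpace T] {π : T → B}
  {lam : ∀ b, Measure {t : T // π t = b}}

theorem IsContinuousFamily.integrable (hlam : IsContinuousFamily π lam) (b : B)
    [T2Space {t : T // π t = b}] {f : {t : T // π t = b} → ℝ} (hf : f ∈ Cc _) :
    Integrable f (lam b) := by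
  have := hlam.regular b
  rw [mem_Cc_iff] at hf
  exact hf.1.integrable_of_hasCompactSupport hf.2

theorem integral_fiber_pos (hlam : IsContinuousFamily π lam) (hfull : HasFullSupport π lam)
    {b : B} [T2Space {t : T // π t = b}] {f : {t : T // π t = b} → ℝ} (hf : f ∈ Cc _)
    (h0 : ∀ t, 0 ≤ f t) {t : {t : T // π t = b}} (ht : f t ≠ 0) : 0 < ∫ t, f t ∂lam b := by
  have := hlam.regular b
  have := hfull b
  rw [mem_Cc_iff] at hf
  exact hf.1.integral_pos_of_hasCompactSupport_nonneg_nonzero hf.2 h0 ht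

variable [T2Space B]

/-- Integration of a jointly continuous function along a continuous family of measures. Near `s₀` the
integrand is uniformly close to `F s₀`, to which the continuity of the family applies. -/
theorem continuousOn_integral_fiber [LocallyCompactSpace T] (hπ : Continuous π)
    (hlam : IsContinuousFamily π lam) (hfib : ∀ b, T2Space {t : T // π t = b}) {σ : S → B}
    (hσ : Continuous σ) {V : Set S} (hV : IsOpen V) {U K : Set T} (hU : IsOpen U) (hUT : T2Space U)
    (hKU : K ⊆ U) (hK : IsCompact K) {F : S → T → ℝ}
    (hF : ContinuousOn (fun p : S × T => F p.1 p.2) (V ×ˢ U))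
    (h0 : ∀ s ∈ V, ∀ t ∉ K, F s t = 0) :
    ContinuousOn (fun s => ∫ t, F s t.1 ∂lam (σ s)) V := by
  obtain ⟨ψ, hψ, hψ0, hψ1⟩ := exists_isTestOn_eq_one hU hUT hKU hK
  have hψc := hψ.mem_Cc hU hUT
  have hFc : ∀ s ∈ V, F s ∈ Cc T := fun s hs =>
    IsTestOn.mem_Cc hU hUT ⟨hF.comp (by fun_prop : ContinuousOn (fun t : T => (s, t)) U)
      fun t ht => ⟨hs, ht⟩, K, hKU, hK, h0 s hs⟩
  have hint : ∀ {f : T → ℝ}, f ∈ Cc T → ∀ b, Integrable (fun t => f t.1) (lam b) :=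
    fun hf b => hlam.integrable b (mem_Cc_comp_isClosedEmbedding hf (isClosedEmbedding_fiber hπ b))
  intro s₀ hs₀
  apply ContinuousAt.continuousWithinAt
  rw [Metric.continuousAt_iff']
  intro ε hε
  have hN : Continuous fun s => ∫ t, ψ t.1 ∂lam (σ s) :=
    (hlam.continuous_integral ψ hψc).comp hσ
  have hC : Continuous fun s => ∫ t, F s₀ t.1 ∂lam (σ s) :=
    (hlam.continuous_integral _ (hFc s₀ hs₀)).comp hσ
  have hNn : ∀ s, 0 ≤ ∫ t, ψ t.1 ∂lam (σ s) := fun s => integral_nonneg fun t => hψ0 _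
  -- `N` bounds the mass near `s₀` of a bump function `ψ` that dominates all the integrands, so an error
  -- of `δ` in the integrand costs at most `ε / 2`.
  set N := (∫ t, ψ t.1 ∂lam (σ s₀)) + 1 with hNdef
  have hNpos : 0 < N := by have := hNn s₀; linarith
  set δ := ε / (2 * N) with hδ
  have hδpos : 0 < δ := by positivity
  have h1 : ∀ᶠ s in 𝓝 s₀, ∀ t ∈ K, |F s t - F s₀ t| < δ := by
    refine hK.eventually_forall_of_forall_eventually fun t ht => ?_
    have hc : ContinuousAt (fun p : S × T => F p.1 p.2) (s₀, t) :=
      hF.continuousAt ((hV.prod hU).mem_nhds ⟨hs₀, hKU ht⟩)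
    have hc' : ContinuousAt (fun p : S × T => F s₀ p.2) (s₀, t) :=
      ContinuousAt.comp (f := fun p : S × T => (s₀, p.2))
        (g := fun p : S × T => F p.1 p.2) hc (by fun_prop)
    have := (hc.sub hc').abs
    refine this.eventually (gt_mem_nhds ?_)
    simpa using hδpos
  filter_upwards [h1, hV.mem_nhds hs₀, hN.continuousAt.eventually_lt_const
    (show (∫ t, ψ t.1 ∂lam (σ s₀)) < N by linarith),
    (Metric.continuousAt_iff'.1 hC.continuousAt) (ε / 2) (half_pos hε)] with s hs hsV hsN hsC
  have h2 : |(∫ t, F s t.1 ∂lam (σ s)) - ∫ t, F s₀ t.1 ∂lam (σ s)| ≤ ε / 2 := by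
    rw [← integral_sub (hint (hFc s hsV) _) (hint (hFc s₀ hs₀) _)]
    refine (abs_integral_le_integral_abs).trans ?_
    have h3 : ∫ t, |F s t.1 - F s₀ t.1| ∂lam (σ s) ≤ ∫ t, δ * ψ t.1 ∂lam (σ s) := by
      refine integral_mono ((hint (hFc s hsV) _).sub (hint (hFc s₀ hs₀) _)).abs
        ((hint hψc _).const_mul δ) fun t => ?_
      by_cases ht : t.1 ∈ K
      · simpa [hψ1 _ ht] using (hs _ ht).le
      · simpa [h0 s hsV _ ht, h0 s₀ hs₀ _ ht] using mul_nonneg hδpos.le (hψ0 t.1)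
    rw [integral_const_mul] at h3
    refine h3.trans ((mul_le_mul_of_nonneg_left hsN.le hδpos.le).trans_eq ?_)
    rw [hδ]
    field_simp
  rw [Real.dist_eq] at hsC ⊢
  calc |(∫ t, F s t.1 ∂lam (σ s)) - ∫ t, F s₀ t.1 ∂lam (σ s₀)|
      ≤ |(∫ t, F s t.1 ∂lam (σ s)) - ∫ t, F s₀ t.1 ∂lam (σ s)| +
        |(∫ t, F s₀ t.1 ∂lam (σ s)) - ∫ t, F s₀ t.1 ∂lam (σ s₀)| := abs_sub_le _ _ _
    _ < ε := by linarith

/-- Integrating out the second variable maps `C_c(S ×_B T)` to `C_c(S)`. -/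
theorem mem_Cc_integral_fiber [LocallyCompactSpace S] (hS : LocallyT2 S) [LocallyCompactSpace T]
    (hT : LocallyT2 T) (hπ : Continuous π)
    (hlam : IsContinuousFamily π lam) (hfib : ∀ b, T2Space {t : T // π t = b}) {σ : S → B}
    (hσ : Continuous σ) {f : FibreProduct σ π → ℝ} (hf : f ∈ Cc (FibreProduct σ π)) :
    (fun s => ∫ t, f (FibreProduct.mk s t.1 t.2.symm) ∂lam (σ s)) ∈ Cc S := by
  have : T1Space S := hS.t1Space
  have : LocallyCompactSpace (FibreProduct σ π) := FibreProduct.locallyCompactSpace hσ hπ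
  set 𝒰 : Set (Set (FibreProduct σ π)) := {W | ∃ V : Set S, ∃ U : Set T, IsOpen V ∧ IsOpen U ∧
    T2Space V ∧ T2Space U ∧ W = {p | p.fst ∈ V ∧ p.snd ∈ U}} with h𝒰
  have hopen : ∀ W ∈ 𝒰, IsOpen W := by
    rintro _ ⟨V, U, hV, hU, -, -, rfl⟩
    exact FibreProduct.isOpen_preimage hV hU
  have hT2 : ∀ W ∈ 𝒰, T2Space W := by
    rintro _ ⟨V, U, -, -, hV, hU, rfl⟩
    exact FibreProduct.t2Space_preimage hV hU
  have hcov : ∀ p, ∃ W ∈ 𝒰, p ∈ W := by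
    intro p
    obtain ⟨V, hV, hpV, hVT⟩ := hS p.fst
    obtain ⟨U, hU, hpU, hUT⟩ := hT p.snd
    exact ⟨_, ⟨V, U, hV, hU, hVT, hUT, rfl⟩, hpV, hpU⟩
  have hsub : Submodule.span ℝ {g | ∃ W ∈ 𝒰, IsTestOn W g} ≤ Cc (FibreProduct σ π) :=
    Submodule.span_le.2 fun g ⟨W, hW, hg⟩ => hg.mem_Cc (hopen W hW) (hT2 W hW)
  have hint : ∀ {f : FibreProduct σ π → ℝ}, f ∈ Cc _ → ∀ s, Integrable
      (fun t : {t : T // π t = σ s} => f (FibreProduct.mk s t.1 t.2.symm)) (lam (σ s)) :=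
    fun hf s => hlam.integrable _
      (mem_Cc_comp_isClosedEmbedding hf (FibreProduct.isClosedEmbedding_slice s))
  have hf' := mem_span_of_cover 𝒰 hopen hT2 hcov hf
  clear hf
  induction hf' using Submodule.span_induction with
  | mem f hf' =>
    obtain ⟨_, ⟨V, U, hV, hU, hVT, hUT, rfl⟩, hfW, K, hKW, hK, h0⟩ := hf'
    have : LocallyCompactSpace V := hV.locallyCompactSpace
    have : LocallyCompactSpace U := hU.locallyCompactSpace
    let W : Set (FibreProduct σ π) := {p | p.fst ∈ V ∧ p.snd ∈ U}
    let e : W → V × U := fun p => (⟨p.1.fst, p.2.1⟩, ⟨p.1.snd, p.2.2⟩)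
    have hec : Continuous e :=
      ((FibreProduct.continuous_fst.comp continuous_subtype_val).subtype_mk _).prodMk
        ((FibreProduct.continuous_snd.comp continuous_subtype_val).subtype_mk _)
    have he : IsClosedEmbedding e := by
      refine ⟨IsEmbedding.of_comp hec (g := fun q : V × U => (q.1.1, q.2.1)) (by fun_prop)
        (FibreProduct.isEmbedding_prod.comp IsEmbedding.subtypeVal), ?_⟩
      have hc : IsClosed {q : V × U | σ q.1.1 = π q.2.1} :=
        isClosed_eq (hσ.comp (continuous_subtype_val.comp _root_.continuous_fst))
          (hπ.comp (continuous_subtype_val.comp _root_.continuous_snd))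
      convert hc using 1
      ext q
      constructor
      · rintro ⟨p, rfl⟩
        exact p.1.w
      · intro hq
        exact ⟨⟨FibreProduct.mk q.1.1 q.2.1 hq, q.1.2, q.2.2⟩, rfl⟩
    have hKc : IsCompact (Subtype.val ⁻¹' K : Set W) :=
      isCompact_preimage_coe hKW hK
    have : T2Space W := FibreProduct.t2Space_preimage hVT hUT
    -- `f` lives on a closed subset of `V × U` only; its values at `(s, t)` with `σ s ≠ π t` are needed
    -- to compare different fibres.
    obtain ⟨F, hFc, hFs, hFe⟩ := exists_continuous_hasCompactSupport_extension he
      (f := fun p : W => f p) hfW.domRestrict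
      (HasCompactSupport.intro hKc fun p hp => h0 _ hp)
    have hF := isTestOn_extendZero (U := V ×ˢ U)
      (g := fun q => F (⟨q.1.1, q.2.1⟩, ⟨q.1.2, q.2.2⟩)) (hFc.comp (by fun_prop))
      (hFs.comp_isClosedEmbedding (Homeomorph.Set.prod V U).isClosedEmbedding)
    set F' : S × T → ℝ := extendZero (V ×ˢ U) (fun q => F (⟨q.1.1, q.2.1⟩, ⟨q.1.2, q.2.2⟩))
    obtain ⟨hF'c, L, hLVU, hL, hF'0⟩ := hF
    have hval : ∀ s (t : {t : T // π t = σ s}),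
        f (FibreProduct.mk s t.1 t.2.symm) = F' (s, t.1) := by
      intro s t
      by_cases h : s ∈ V ∧ t.1 ∈ U
      · rw [show F' (s, t.1) = _ from extendZero_of_mem _ (show (s, t.1) ∈ V ×ˢ U from h)]
        exact (hFe ⟨FibreProduct.mk s t.1 t.2.symm, h⟩).symm
      · rw [hF'0 _ fun h' => h (hLVU h'), h0 _ fun h' => h (hKW h')]
    simp_rw [hval]
    refine IsTestOn.mem_Cc hV hVT ⟨?_, Prod.fst '' L, ?_, hL.image _root_.continuous_fst, ?_⟩
    · refine continuousOn_integral_fiber hπ hlam hfib hσ hV hU hUT (K := Prod.snd '' L) ?_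
        (hL.image _root_.continuous_snd) (F := fun s t => F' (s, t)) hF'c ?_
      · rintro _ ⟨q, hq, rfl⟩
        exact (hLVU hq).2
      · intro s _ t ht
        exact hF'0 _ fun h => ht ⟨_, h, rfl⟩
    · rintro _ ⟨q, hq, rfl⟩
      exact (hLVU hq).1
    · intro s hs
      have : ∀ t, F' (s, t) = 0 := fun t => hF'0 _ fun h => hs ⟨_, h, rfl⟩
      simp [this]
  | zero =>
    convert (Cc S).zero_mem using 1
    ext s
    simp
  | add f g hf hg hIf hIg =>
    convert (Cc S).add_mem hIf hIg using 1
    ext s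
    simp only [Pi.add_apply]
    exact integral_add (hint (hsub hf) s) (hint (hsub hg) s)
  | smul a f hf hIf =>
    convert (Cc S).smul_mem a hIf using 1
    ext s
    simp only [Pi.smul_apply, smul_eq_mul]
    exact integral_const_mul _ _

/-- The base map of a continuous family of measures of full support is open. -/
theorem isOpenMap_of_hasFullSupport [LocallyCompactSpace T] (hT : LocallyT2 T)
    (hπ : Continuous π) (hlam : IsContinuousFamily π lam) (hfull : HasFullSupport π lam)
    (hfib : ∀ b, T2Space {t : T // π t = b}) : IsOpenMap π := by
  intro W hW
  rw [isOpen_iff_mem_nhds]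
  rintro _ ⟨t, ht, rfl⟩
  obtain ⟨U, hUW, hU, hUT, htU, f, hf, hf0, hf1⟩ := exists_mem_Cc_pos hT hW ht
  have hfc := hf.mem_Cc hU hUT
  have hpos := integral_fiber_pos hlam hfull (b := π t)
    (mem_Cc_comp_isClosedEmbedding hfc (isClosedEmbedding_fiber hπ (π t))) (fun _ => hf0 _)
    (t := ⟨t, rfl⟩) (by simp [hf1])
  filter_upwards [(hlam.continuous_integral f hfc).continuousAt.eventually_const_lt hpos] with b hb
  by_contra hbW
  refine hb.ne' (integral_eq_zero_of_ae (Filter.Eventually.of_forall fun t' => ?_))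
  obtain ⟨K, hKU, -, hK0⟩ := hf.2
  exact hK0 _ fun h => hbW ⟨_, hUW (hKU h), t'.2⟩

end Family

/-! ### Groupoids, translations and Fubini's theorem -/

/-- Limits are unique inside an open Hausdorff subset. -/
theorem eq_of_le_nhds_of_mem {T : Type*} [TopologicalSpace T] {U : Set T} (hU : IsOpen U)
    (hT : T2Space U) {x y : T} (hx : x ∈ U) (hy : y ∈ U) {l : Filter T} [l.NeBot]
    (hlx : l ≤ 𝓝 x) (hly : l ≤ 𝓝 y) : x = y := by
  have h : (𝓝 x ⊓ 𝓝 y).NeBot := Filter.neBot_of_le (le_inf hlx hly)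
  rw [← map_nhds_subtype_coe_eq_nhds hx (hU.mem_nhds hx),
    ← map_nhds_subtype_coe_eq_nhds hy (hU.mem_nhds hy),
    ← Filter.map_inf Subtype.val_injective, Filter.map_neBot_iff] at h
  exact congrArg Subtype.val (eq_of_nhds_neBot h)

section Groupoid

variable {B G : Type*} [TopologicalSpace B] [TopologicalSpace G] (𝓖 : TopGroupoid B G)

theorem TopGroupoid.inv_mul_cancel_left (g h : G) (e : 𝓖.s g = 𝓖.r h) :
    𝓖.mul (𝓖.inv g) (𝓖.mul g h e) ((𝓖.s_inv g).trans (𝓖.r_mul _ _ _).symm) = h := by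
  rw [← 𝓖.mul_assoc (𝓖.inv g) g h (𝓖.s_inv g) e,
    𝓖.mul_congr ((𝓖.inv_mul g).trans (congrArg 𝓖.unit e)) rfl _ (𝓖.s_unit _)]
  exact 𝓖.unit_mul h

theorem TopGroupoid.inv_inv (g : G) : 𝓖.inv (𝓖.inv g) = g := by
  refine (𝓖.inv_eq (𝓖.r_inv g).symm ?_).symm
  rw [𝓖.mul_inv, 𝓖.s_inv]

theorem TopGroupoid.mul_inv_cancel_left (g h : G) (e : 𝓖.r g = 𝓖.r h) :
    𝓖.mul g (𝓖.mul (𝓖.inv g) h ((𝓖.s_inv g).trans e)) ((𝓖.r_inv g).symm.trans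
      (𝓖.r_mul _ _ _).symm) = h := by
  refine (𝓖.mul_congr (𝓖.inv_inv g).symm rfl _
    ((𝓖.s_inv _).trans (𝓖.r_mul _ _ _).symm)).trans ?_
  exact 𝓖.inv_mul_cancel_left _ _ _

/-- Inversion as a self-homeomorphism of the space of arrows. -/
def TopGroupoid.invHomeomorph : G ≃ₜ G where
  toFun := 𝓖.inv
  invFun := 𝓖.inv
  left_inv := 𝓖.inv_inv
  right_inv := 𝓖.inv_inv
  continuous_toFun := 𝓖.continuous_inv
  continuous_invFun := 𝓖.continuous_inv

theorem LeftAction.inv_act {X : Type*} [TopologicalSpace X] {𝓖 : TopGroupoid B G}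
    (L : LeftAction 𝓖 X) (g : G) (x : X) (e : 𝓖.s g = L.mom x) :
    L.act (𝓖.inv g) (L.act g x e) ((𝓖.s_inv g).trans (L.mom_act _ _ _).symm) = x := by
  rw [← L.mul_act (𝓖.inv g) g x (𝓖.s_inv g) e]
  exact (L.act_congr ((𝓖.inv_mul g).trans (congrArg 𝓖.unit e)) rfl _ (𝓖.s_unit _)).trans
    (L.unit_act x)

/-- The range fibres of a locally Hausdorff groupoid with Hausdorff unit space are Hausdorff, even
if the groupoid is not: if `a` and `c` run through an ultrafilter on the fibre that converges to
both `g` and `h`, the arrows `a⁻¹ c` converge to `a⁻¹ g` and to `a⁻¹ h`, and both of these lie in a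
Hausdorff neighbourhood of a unit once `a` is far out. -/
theorem TopGroupoid.t2Space_fiber [T2Space B] (hG : LocallyT2 G) (b : B) :
    T2Space {g : G // 𝓖.r g = b} := by
  rw [t2_iff_ultrafilter]
  intro g h f hg hh
  have hs : Continuous fun a : {g : G // 𝓖.r g = b} => 𝓖.s a.1 :=
    𝓖.continuous_s.comp continuous_subtype_val
  have hsgh : 𝓖.s g.1 = 𝓖.s h.1 :=
    tendsto_nhds_unique ((hs.tendsto g).mono_left hg) ((hs.tendsto h).mono_left hh)
  have hcomp : ∀ a c : {g : G // 𝓖.r g = b}, 𝓖.s (𝓖.inv a.1) = 𝓖.r c.1 := fun a c =>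
    (𝓖.s_inv _).trans (a.2.trans c.2.symm)
  let D : {g : G // 𝓖.r g = b} × {g : G // 𝓖.r g = b} → G := fun p =>
    𝓖.mul (𝓖.inv p.1.1) p.2.1 (hcomp _ _)
  have hD : Continuous D := 𝓖.continuous_mul.comp (FibreProduct.continuous_mk
    (𝓖.continuous_inv.comp (continuous_subtype_val.comp continuous_fst))
    (continuous_subtype_val.comp continuous_snd) fun p => hcomp p.1 p.2)
  obtain ⟨U, hU, h1, hUT⟩ := hG (𝓖.unit (𝓖.s g.1))
  have key : ∀ k : {g : G // 𝓖.r g = b}, 𝓖.s k.1 = 𝓖.s g.1 → (f : Filter _) ≤ 𝓝 k →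
      ∀ᶠ a in (f : Filter _), D (a, k) ∈ U := by
    intro k hk hfk
    have hc : ContinuousAt (fun a => D (a, k)) k := by fun_prop
    refine hfk (hc.preimage_mem_nhds (hU.mem_nhds ?_))
    have : D (k, k) = 𝓖.unit (𝓖.s g.1) := (𝓖.inv_mul k.1).trans (congrArg _ hk)
    exact this ▸ h1
  obtain ⟨a, hag, hah⟩ := ((key g rfl hg).and (key h hsgh.symm hh)).exists
  have hDa : Continuous fun c => D (a, c) := by fun_prop
  have := eq_of_le_nhds_of_mem hU hUT hag hah (l := Filter.map (fun c => D (a, c)) f)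
    ((hDa.tendsto g).mono_left hg) ((hDa.tendsto h).mono_left hh)
  refine Subtype.ext ?_
  rw [← 𝓖.mul_inv_cancel_left a.1 g.1 (a.2.trans g.2.symm),
    ← 𝓖.mul_inv_cancel_left a.1 h.1 (a.2.trans h.2.symm)]
  exact 𝓖.mul_congr rfl this _ _

end Groupoid

section LeftAction

variable {B G X : Type*} [TopologicalSpace B] [TopologicalSpace G] [TopologicalSpace X]
  {𝓖 : TopGroupoid B G}

/-- The right action `x g = g⁻¹ x` defined by a left action. -/
def LeftAction.toRight (L : LeftAction 𝓖 X) : RightAction 𝓖 X where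
  mom := L.mom
  act x g e := L.act (𝓖.inv g) x ((𝓖.s_inv g).trans e.symm)
  mom_act _ g _ := (L.mom_act _ _ _).trans (𝓖.r_inv g)
  act_unit _ := (L.act_congr (𝓖.inv_unit _) rfl _ (𝓖.s_unit _)).trans (L.unit_act _)
  act_mul _ g h e₁ e' := (L.act_congr (𝓖.inv_mul_rev g h e') rfl _
      ((𝓖.s_mul _ _ _).trans ((𝓖.s_inv g).trans e₁.symm))).trans (L.mul_act _ _ _ _ _)
  continuous_mom := L.continuous_mom
  continuous_act := L.continuous_act.comp (FibreProduct.continuous_mk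
    (𝓖.continuous_inv.comp FibreProduct.continuous_snd) FibreProduct.continuous_fst
    fun p => (𝓖.s_inv p.snd).trans p.w.symm)

/-- The involution `(x, g) ↦ (g⁻¹ x, g⁻¹)`, the inversion of the groupoid `X ⋊ G` of the right
action `x g = g⁻¹ x`. -/
def LeftAction.pairInv (L : LeftAction 𝓖 X) (p : FibreProduct L.mom 𝓖.r) :
    FibreProduct L.mom 𝓖.r :=
  L.toRight.transformation.inv p

theorem LeftAction.pairInv_pairInv (L : LeftAction 𝓖 X) (p : FibreProduct L.mom 𝓖.r) :
    L.pairInv (L.pairInv p) = p :=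
  L.toRight.transformation.inv_inv p

theorem LeftAction.continuous_pairInv (L : LeftAction 𝓖 X) : Continuous L.pairInv :=
  L.toRight.transformation.continuous_inv

end LeftAction

/-- Fubini's theorem for test functions; the measures need not be σ-finite. -/
theorem integral_integral_swap_of_mem_Cc {S T : Type*} [TopologicalSpace S] [TopologicalSpace T]
    [T2Space S] [T2Space T] [MeasurableSpace S] [BorelSpace S] [MeasurableSpace T] [BorelSpace T]
    {μ : Measure S} {ν : Measure T} [IsFiniteMeasureOnCompacts μ] [IsFiniteMeasureOnCompacts ν]
    {f : S × T → ℝ} (hf : f ∈ Cc (S × T)) :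
    ∫ s, ∫ t, f (s, t) ∂ν ∂μ = ∫ t, ∫ s, f (s, t) ∂μ ∂ν := by
  rw [mem_Cc_iff] at hf
  exact integral_integral_swap_of_hasCompactSupport (f := fun s t => f (s, t)) hf.1 hf.2

theorem integral_map_of_continuous {S T : Type*} [TopologicalSpace S] [TopologicalSpace T]
    [MeasurableSpace S] [BorelSpace S] [MeasurableSpace T] [BorelSpace T] {μ : Measure S}
    {j : S → T} (hj : Continuous j) {f : T → ℝ} (hf : Continuous f) :
    ∫ t, f t ∂μ.map j = ∫ s, f (j s) ∂μ :=
  integral_map hj.measurable.aemeasurable hf.aestronglyMeasurable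

section Translation

variable {B G : Type*} [TopologicalSpace B] [TopologicalSpace G] [MeasurableSpace G]
  [BorelSpace G] {𝓖 : TopGroupoid B G}

/-- Left translation by `g`, for fibres over points that are only propositionally equal to `r g` and
`s g`. -/
theorem HaarSystem.integral_translate (chi : HaarSystem 𝓖) (g : G) {b b' : B} (hb : 𝓖.r g = b)
    (hb' : 𝓖.s g = b') {F : {h : G // 𝓖.r h = b} → ℝ} (hF : Continuous F) :
    ∫ h, F h ∂chi.measure b =
      ∫ h, F ⟨𝓖.mul g h.1 (hb'.trans h.2.symm), (𝓖.r_mul _ _ _).trans hb⟩ ∂chi.measure b' := by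
  subst hb hb'
  rw [← chi.left_invariant g]
  refine integral_map_of_continuous ?_ hF
  exact (𝓖.continuous_mul.comp (FibreProduct.continuous_mk continuous_const
    continuous_subtype_val fun h => h.2.symm)).subtype_mk _

/-- The measure of the induced Haar system at `x` is the image of `chi` at the momentum of `x` under
a homeomorphism. -/
theorem RightAction.integral_inducedHaar {X : Type*} [TopologicalSpace X] [T1Space X]
    (R : RightAction 𝓖 X) (chi : HaarSystem 𝓖) (x : X) (f : FibreProduct R.mom 𝓖.r → ℝ) :
    ∫ p, f p.1 ∂(R.inducedHaar chi x) =
      ∫ g, f (FibreProduct.mk x g.1 g.2.symm) ∂chi.measure (R.mom x) := by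
  unfold RightAction.inducedHaar
  have hslice := FibreProduct.isClosedEmbedding_slice (σ := R.mom) (π := 𝓖.r) x
  have hj : IsClosedEmbedding fun g : {g : G // 𝓖.r g = R.mom x} =>
      (⟨FibreProduct.mk x g.1 g.2.symm, rfl⟩ :
        {p : FibreProduct R.mom 𝓖.r // R.transformation.r p = x}) :=
    IsClosedEmbedding.of_comp_iff (hg := IsClosedEmbedding.subtypeVal
      (isClosed_singleton.preimage R.transformation.continuous_r)) |>.1 hslice
  exact hj.measurableEmbedding.integral_map _

end Translation

section Correspondence

variable {B G C H X : Type*} [TopologicalSpace B] [TopologicalSpace G]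
  [TopologicalSpace C] [TopologicalSpace H] [MeasurableSpace G] [MeasurableSpace H]
  {𝓖 : TopGroupoid B G} {𝓗 : TopGroupoid C H} {chi : HaarSystem 𝓖} {kappa : HaarSystem 𝓗}
  [TopologicalSpace X] [MeasurableSpace X]

/-- Right translation by `h`, for fibres over points that are only propositionally equal to `r h` and
`s h`. -/
theorem TopCorrespondence.integral_translate [BorelSpace X] (P : TopCorrespondence chi kappa X)
    (h : H) {c c' : C} (hc : 𝓗.r h = c) (hc' : 𝓗.s h = c') {F : {x : X // P.right.mom x = c'} → ℝ}
    (hF : Continuous F) :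
    ∫ x, F x ∂P.lam c' =
      ∫ x, F ⟨P.right.act x.1 h (x.2.trans hc.symm), (P.right.mom_act _ _ _).trans hc'⟩
        ∂P.lam c := by
  subst hc hc'
  rw [← P.invariant h]
  refine integral_map_of_continuous ?_ hF
  exact (P.right.continuous_act.comp (FibreProduct.continuous_mk continuous_subtype_val
    continuous_const fun x => x.2)).subtype_mk _

/-- The adjoining function in the coordinates of the groupoid `X ⋊ G` for the right action
`x g = g⁻¹ x`: the value at `(x, g)` is `adj (g, g⁻¹ x)`. -/
def TopCorrespondence.weight (P : TopCorrespondence chi kappa X)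
    (p : FibreProduct P.left.mom 𝓖.r) : ℝ :=
  P.adj (FibreProduct.mk p.snd (P.left.toRight.act p.fst p.snd p.w)
    (P.left.toRight.mom_act p.fst p.snd p.w).symm)

theorem TopCorrespondence.continuous_weight (P : TopCorrespondence chi kappa X) :
    Continuous P.weight :=
  P.adj_continuous.comp (FibreProduct.continuous_mk FibreProduct.continuous_snd
    P.left.toRight.continuous_act fun p => (P.left.toRight.mom_act p.fst p.snd p.w).symm)

/-- The adjoining relation, written on the transformation groupoid of the right action
`x g = g⁻¹ x`. -/
theorem TopCorrespondence.integral_inv (P : TopCorrespondence chi kappa X) (c : C)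
    {Φ : FibreProduct P.left.mom 𝓖.r → ℝ} (hΦ : Φ ∈ Cc (FibreProduct P.left.mom 𝓖.r)) :
    ∫ x, ∫ g, Φ (FibreProduct.mk x.1 g.1 g.2.symm) ∂chi.measure (P.left.mom x.1) ∂P.lam c =
      ∫ x, ∫ g, Φ (P.left.pairInv (FibreProduct.mk x.1 g.1 g.2.symm)) *
        P.weight (FibreProduct.mk x.1 g.1 g.2.symm) ∂chi.measure (P.left.mom x.1) ∂P.lam c := by
  let E : FibreProduct 𝓖.s P.left.mom ≃ₜ FibreProduct P.left.mom 𝓖.r :=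
    { toFun := fun q => FibreProduct.mk q.snd (𝓖.inv q.fst) (q.w.symm.trans (𝓖.r_inv _).symm)
      invFun := fun p => FibreProduct.mk (𝓖.inv p.snd) p.fst ((𝓖.s_inv _).trans p.w.symm)
      left_inv := fun q => FibreProduct.ext' (𝓖.inv_inv _) rfl
      right_inv := fun q => FibreProduct.ext' rfl (𝓖.inv_inv _)
      continuous_toFun := FibreProduct.continuous_mk FibreProduct.continuous_snd
        (𝓖.continuous_inv.comp FibreProduct.continuous_fst) _
      continuous_invFun := FibreProduct.continuous_mk
        (𝓖.continuous_inv.comp FibreProduct.continuous_snd) FibreProduct.continuous_fst _ }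
  have h := P.adj_spec c _ (mem_Cc_comp_isClosedEmbedding hΦ E.isClosedEmbedding)
  refine Eq.trans ?_ h
  refine integral_congr_ae (.of_forall fun x => integral_congr_ae (.of_forall fun g => ?_))
  exact congrArg Φ (FibreProduct.ext' rfl (𝓖.inv_inv _).symm)

end Correspondence

/-! ### The adjoining function is a cocycle -/

section FibreIntegral

variable {S T B : Type*} [TopologicalSpace S] [TopologicalSpace T] [TopologicalSpace B]
  [MeasurableSpace T] [BorelSpace T] {π : T → B}
  {lam : ∀ b, Measure {t : T // π t = b}}

/-- Functions in `C_c(S ×_B T)` can be integrated along the fibres of the second variable. -/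
theorem integrable_slice [T1Space S] (hlam : IsContinuousFamily π lam)
    (hfib : ∀ b, T2Space {t : T // π t = b}) {σ : S → B} {f : FibreProduct σ π → ℝ}
    (hf : f ∈ Cc (FibreProduct σ π)) (s : S) :
    Integrable (fun t : {t : T // π t = σ s} => f (FibreProduct.mk s t.1 t.2.symm)) (lam (σ s)) :=
  hlam.integrable _ (mem_Cc_comp_isClosedEmbedding hf (FibreProduct.isClosedEmbedding_slice s))

theorem integral_slice_pos [T1Space S] (hlam : IsContinuousFamily π lam)
    (hfull : HasFullSupport π lam) (hfib : ∀ b, T2Space {t : T // π t = b}) {σ : S → B}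
    {f : FibreProduct σ π → ℝ} (hf : f ∈ Cc (FibreProduct σ π)) (h0 : ∀ p, 0 ≤ f p)
    {p : FibreProduct σ π} (hp : f p ≠ 0) :
    ∫ t, f (FibreProduct.mk p.fst t.1 t.2.symm) ∂lam (σ p.fst) ≠ 0 :=
  (integral_fiber_pos hlam hfull
    (mem_Cc_comp_isClosedEmbedding hf (FibreProduct.isClosedEmbedding_slice p.fst))
    (fun _ => h0 _) (t := ⟨p.snd, p.w.symm⟩) hp).ne'

end FibreIntegral

section Triple

variable {B G X : Type*} [TopologicalSpace B] [TopologicalSpace G] [TopologicalSpace X]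
  {𝓖 : TopGroupoid B G}

/-- The space of triples `(x, g, h)` with `g` and `h` in the range fibre over the momentum of `x`. -/
abbrev LeftAction.Triple (L : LeftAction 𝓖 X) : Type _ :=
  FibreProduct (fun p : FibreProduct L.mom 𝓖.r => L.mom p.fst) 𝓖.r

/-- The involution `(x, g, h) ↦ (x, h, g)`. -/
def LeftAction.tripleSwap (L : LeftAction 𝓖 X) : L.Triple ≃ₜ L.Triple where
  toFun q := FibreProduct.mk (FibreProduct.mk q.fst.fst q.snd q.w) q.fst.snd q.fst.w
  invFun q := FibreProduct.mk (FibreProduct.mk q.fst.fst q.snd q.w) q.fst.snd q.fst.w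
  left_inv _ := rfl
  right_inv _ := rfl
  continuous_toFun := FibreProduct.continuous_mk
    (FibreProduct.continuous_mk (FibreProduct.continuous_fst.comp FibreProduct.continuous_fst)
      FibreProduct.continuous_snd _)
    (FibreProduct.continuous_snd.comp FibreProduct.continuous_fst) _
  continuous_invFun := FibreProduct.continuous_mk
    (FibreProduct.continuous_mk (FibreProduct.continuous_fst.comp FibreProduct.continuous_fst)
      FibreProduct.continuous_snd _)
    (FibreProduct.continuous_snd.comp FibreProduct.continuous_fst) _

/-- The map `(x, g, h) ↦ (g⁻¹ x, g⁻¹, g⁻¹ h)`. -/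
def LeftAction.tripleInvFun (L : LeftAction 𝓖 X) (q : L.Triple) : L.Triple :=
  FibreProduct.mk (L.pairInv q.fst)
    (𝓖.mul (𝓖.inv q.fst.snd) q.snd ((𝓖.s_inv _).trans (q.fst.w.symm.trans q.w)))
    ((L.toRight.mom_act _ _ q.fst.w).trans ((𝓖.r_inv _).symm.trans (𝓖.r_mul _ _ _).symm))

theorem LeftAction.tripleInvFun_tripleInvFun (L : LeftAction 𝓖 X) (q : L.Triple) :
    L.tripleInvFun (L.tripleInvFun q) = q := by
  refine FibreProduct.ext' (L.pairInv_pairInv _) ?_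
  refine (𝓖.mul_congr (𝓖.inv_inv _) rfl _
    ((𝓖.r_inv _).symm.trans (𝓖.r_mul _ _ _).symm)).trans ?_
  exact 𝓖.mul_inv_cancel_left _ _ (q.fst.w.symm.trans q.w)

theorem LeftAction.continuous_tripleInvFun (L : LeftAction 𝓖 X) : Continuous L.tripleInvFun := by
  refine FibreProduct.continuous_mk
    (L.continuous_pairInv.comp FibreProduct.continuous_fst) ?_ _
  exact 𝓖.continuous_mul.comp (FibreProduct.continuous_mk
    (𝓖.continuous_inv.comp (FibreProduct.continuous_snd.comp FibreProduct.continuous_fst))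
    FibreProduct.continuous_snd
    fun q : L.Triple => (𝓖.s_inv _).trans (q.fst.w.symm.trans q.w))

/-- The involution `(x, g, h) ↦ (g⁻¹ x, g⁻¹, g⁻¹ h)`. -/
def LeftAction.tripleInv (L : LeftAction 𝓖 X) : L.Triple ≃ₜ L.Triple where
  toFun := L.tripleInvFun
  invFun := L.tripleInvFun
  left_inv := L.tripleInvFun_tripleInvFun
  right_inv := L.tripleInvFun_tripleInvFun
  continuous_toFun := L.continuous_tripleInvFun
  continuous_invFun := L.continuous_tripleInvFun

theorem LeftAction.tripleInv_tripleInv (L : LeftAction 𝓖 X) (q : L.Triple) :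
    L.tripleInv (L.tripleInv q) = q := L.tripleInvFun_tripleInvFun q

/-- The two involutions satisfy the braid relation. A triple `(x, g, h)` is a 2-simplex of `X ⋊ G`
with vertices `x`, `g⁻¹ x` and `h⁻¹ x`, and the involutions transpose the first two and the last two
vertices. -/
theorem LeftAction.triple_braid (L : LeftAction 𝓖 X) (q : L.Triple) :
    L.tripleInv (L.tripleSwap (L.tripleInv q)) =
      L.tripleSwap (L.tripleInv (L.tripleSwap q)) := by
  have e : 𝓖.r q.fst.snd = 𝓖.r q.snd := q.fst.w.symm.trans q.w
  have e1 : 𝓖.s (𝓖.inv q.fst.snd) = 𝓖.r q.snd := (𝓖.s_inv _).trans e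
  have h1 : 𝓖.inv (𝓖.mul (𝓖.inv q.fst.snd) q.snd e1) =
      𝓖.mul (𝓖.inv q.snd) q.fst.snd ((𝓖.s_inv _).trans e.symm) :=
    (𝓖.inv_mul_rev _ _ _).trans (𝓖.mul_congr rfl (𝓖.inv_inv _) _ _)
  refine FibreProduct.ext' (FibreProduct.ext' ?_ h1) ?_
  · refine (L.toRight.act_mul q.fst.fst q.fst.snd _ q.fst.w
      ((𝓖.r_inv _).symm.trans (𝓖.r_mul _ _ _).symm)).symm.trans ?_
    exact L.toRight.act_congr rfl (𝓖.mul_inv_cancel_left _ _ e) _ q.w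
  · refine (𝓖.mul_congr h1 rfl _
      ((𝓖.s_mul _ _ _).trans (𝓖.r_inv _).symm)).trans ?_
    refine (𝓖.mul_assoc _ _ _ _ (𝓖.r_inv _).symm).trans ?_
    refine (𝓖.mul_congr rfl ((𝓖.mul_inv _).trans
      (congrArg 𝓖.unit (e.trans (𝓖.s_inv q.snd).symm))) _ (𝓖.r_unit _).symm).trans ?_
    exact 𝓖.mul_unit _

theorem LeftAction.locallyT2_pair [T2Space X] (hG : LocallyT2 G)
    (L : LeftAction 𝓖 X) : LocallyT2 (FibreProduct L.mom 𝓖.r) :=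
  FibreProduct.locallyT2 .of_t2Space hG

variable [MeasurableSpace G] [BorelSpace G] {chi : HaarSystem 𝓖} [T2Space B] [LocallyCompactSpace G]
  [LocallyCompactSpace X] [T2Space X]

theorem LeftAction.integral_triple_mem_Cc (hG : LocallyT2 G) (L : LeftAction 𝓖 X) {Ψ : L.Triple → ℝ}
    (hΨ : Ψ ∈ Cc L.Triple) :
    (fun p : FibreProduct L.mom 𝓖.r =>
      ∫ h, Ψ (FibreProduct.mk p h.1 h.2.symm) ∂chi.measure (L.mom p.fst)) ∈ Cc _ := by
  have : LocallyCompactSpace (FibreProduct L.mom 𝓖.r) :=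
    FibreProduct.locallyCompactSpace L.continuous_mom 𝓖.continuous_r
  exact mem_Cc_integral_fiber (LeftAction.locallyT2_pair hG L) hG 𝓖.continuous_r
    chi.continuousFamily (𝓖.t2Space_fiber hG) (L.continuous_mom.comp FibreProduct.continuous_fst) hΨ

theorem LeftAction.integral_pair_mem_Cc (hG : LocallyT2 G) (L : LeftAction 𝓖 X)
    {Φ : FibreProduct L.mom 𝓖.r → ℝ}
    (hΦ : Φ ∈ Cc (FibreProduct L.mom 𝓖.r)) :
    (fun x => ∫ g, Φ (FibreProduct.mk x g.1 g.2.symm) ∂chi.measure (L.mom x)) ∈ Cc X :=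
  mem_Cc_integral_fiber .of_t2Space hG 𝓖.continuous_r chi.continuousFamily
    (𝓖.t2Space_fiber hG) L.continuous_mom hΦ

end Triple

section Cocycle

variable {B G C H X : Type*} [TopologicalSpace B] [TopologicalSpace G]
  [TopologicalSpace C] [TopologicalSpace H] [MeasurableSpace G] [BorelSpace G] [MeasurableSpace H]
  {𝓖 : TopGroupoid B G} {𝓗 : TopGroupoid C H} {chi : HaarSystem 𝓖} {kappa : HaarSystem 𝓗}
  [TopologicalSpace X] [MeasurableSpace X]

/-- The iterated integral `∫ ∫ ∫ Ψ(x, g, h) dχ(h) dχ(g) dλ_c(x)`. -/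
noncomputable def TopCorrespondence.tripleIntegral (P : TopCorrespondence chi kappa X) (c : C)
    (Ψ : P.left.Triple → ℝ) : ℝ :=
  ∫ x, ∫ g, ∫ h, Ψ (FibreProduct.mk (FibreProduct.mk x.1 g.1 g.2.symm) h.1 h.2.symm)
    ∂chi.measure (P.left.mom (FibreProduct.mk x.1 g.1 g.2.symm : FibreProduct _ 𝓖.r).fst)
    ∂chi.measure (P.left.mom x.1) ∂P.lam c

section

variable [T2Space B] (hG : LocallyT2 G) [T2Space X] (P : TopCorrespondence chi kappa X) (c : C)

include hG

/-- Fubini's theorem on each fibre. -/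
theorem TopCorrespondence.tripleIntegral_swap {Ψ : P.left.Triple → ℝ}
    (hΨ : Ψ ∈ Cc P.left.Triple) :
    P.tripleIntegral c Ψ = P.tripleIntegral c fun q => Ψ (P.left.tripleSwap q) := by
  refine integral_congr_ae (.of_forall fun x => ?_)
  have := 𝓖.t2Space_fiber hG (P.left.mom x.1)
  have := chi.continuousFamily.regular (P.left.mom x.1)
  have hcont : Continuous fun q : {g : G // 𝓖.r g = P.left.mom x.1} ×
      {g : G // 𝓖.r g = P.left.mom x.1} =>
      (FibreProduct.mk (FibreProduct.mk x.1 q.1.1 q.1.2.symm) q.2.1 q.2.2.symm :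
        P.left.Triple) :=
    FibreProduct.continuous_mk (FibreProduct.continuous_mk continuous_const
      (continuous_subtype_val.comp continuous_fst) _)
      (continuous_subtype_val.comp continuous_snd) _
  have hj : IsClosedEmbedding fun q : {g : G // 𝓖.r g = P.left.mom x.1} ×
      {g : G // 𝓖.r g = P.left.mom x.1} =>
      (FibreProduct.mk (FibreProduct.mk x.1 q.1.1 q.1.2.symm) q.2.1 q.2.2.symm :
        P.left.Triple) := by
    refine ⟨IsEmbedding.of_comp hcont (g := fun q : P.left.Triple => (q.fst.snd, q.snd))
      ((FibreProduct.continuous_snd.comp FibreProduct.continuous_fst).prodMk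
        FibreProduct.continuous_snd) (IsEmbedding.subtypeVal.prodMap IsEmbedding.subtypeVal), ?_⟩
    convert (isClosed_singleton (x := x.1)).preimage
      ((FibreProduct.continuous_fst.comp FibreProduct.continuous_fst :
        Continuous fun q : P.left.Triple => q.fst.fst)) using 1
    ext q
    constructor
    · rintro ⟨t, rfl⟩
      rfl
    · intro hq
      have hq' : q.fst.fst = x.1 := hq
      exact ⟨(⟨q.fst.snd, q.fst.w.symm.trans (congrArg P.left.mom hq')⟩,
        ⟨q.snd, q.w.symm.trans (congrArg P.left.mom hq')⟩),
        FibreProduct.ext' (FibreProduct.ext' hq'.symm rfl) rfl⟩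
  exact integral_integral_swap_of_mem_Cc (μ := chi.measure (P.left.mom x.1))
    (ν := chi.measure (P.left.mom x.1)) (mem_Cc_comp_isClosedEmbedding hΨ hj)

variable [LocallyCompactSpace G] [LocallyCompactSpace X]

/-- The adjoining relation, followed by a left translation in the third variable. -/
theorem TopCorrespondence.tripleIntegral_inv {Ψ : P.left.Triple → ℝ}
    (hΨ : Ψ ∈ Cc P.left.Triple) :
    P.tripleIntegral c Ψ =
      P.tripleIntegral c fun q => Ψ (P.left.tripleInv q) * P.weight q.fst := by
  have : T1Space (FibreProduct P.left.mom 𝓖.r) := (LeftAction.locallyT2_pair hG P.left).t1Space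
  refine (P.integral_inv c (P.left.integral_triple_mem_Cc hG hΨ)).trans ?_
  refine integral_congr_ae (.of_forall fun x => integral_congr_ae (.of_forall fun g => ?_))
  refine Eq.trans (congrArg (· * _) ?_) (integral_mul_const _ _).symm
  have := 𝓖.t2Space_fiber hG
  have hc := ((mem_Cc_iff _).1 (mem_Cc_comp_isClosedEmbedding hΨ
    (FibreProduct.isClosedEmbedding_slice (P.left.pairInv
      (FibreProduct.mk x.1 g.1 g.2.symm))))).1
  exact chi.integral_translate (𝓖.inv g.1) ((P.left.toRight.mom_act _ _ g.2.symm).trans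
    (𝓖.r_inv g.1).symm).symm ((𝓖.s_inv _).trans g.2) hc

variable [BorelSpace X]

theorem TopCorrespondence.tripleIntegral_sub {Ψ Ψ' : P.left.Triple → ℝ}
    (hC : T2Space C)
    (hΨ : Ψ ∈ Cc P.left.Triple) (hΨ' : Ψ' ∈ Cc P.left.Triple) :
    P.tripleIntegral c (fun q => Ψ q - Ψ' q) = P.tripleIntegral c Ψ - P.tripleIntegral c Ψ' := by
  have : T1Space (FibreProduct P.left.mom 𝓖.r) := (LeftAction.locallyT2_pair hG P.left).t1Space
  have hfib := 𝓖.t2Space_fiber hG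
  have hX : ∀ {Φ : FibreProduct P.left.mom 𝓖.r → ℝ}, Φ ∈ Cc _ → Integrable (fun x : {x : X //
      P.right.mom x = c} => ∫ g, Φ (FibreProduct.mk x.1 g.1 g.2.symm)
        ∂chi.measure (P.left.mom x.1)) (P.lam c) := fun hΦ =>
    P.continuousFamily.integrable c (mem_Cc_comp_isClosedEmbedding
      (P.left.integral_pair_mem_Cc hG hΦ) (isClosedEmbedding_fiber P.right.continuous_mom c))
  have h1 := P.left.integral_triple_mem_Cc (chi := chi) hG hΨ
  have h2 := P.left.integral_triple_mem_Cc (chi := chi) hG hΨ'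
  unfold TopCorrespondence.tripleIntegral
  refine Eq.trans ?_ (integral_sub (hX h1) (hX h2))
  refine integral_congr_ae (.of_forall fun x => ?_)
  refine Eq.trans ?_ (integral_sub (integrable_slice chi.continuousFamily hfib h1 x.1)
    (integrable_slice chi.continuousFamily hfib h2 x.1))
  refine integral_congr_ae (.of_forall fun g => ?_)
  exact integral_sub (integrable_slice chi.continuousFamily hfib hΨ _)
    (integrable_slice chi.continuousFamily hfib hΨ' _)

/-- Full support of `χ`, used twice, and of `λ`. -/
theorem TopCorrespondence.tripleIntegral_ne_zero (hC : T2Space C) {Ψ : P.left.Triple → ℝ}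
    (hΨ : Ψ ∈ Cc P.left.Triple) (h0 : ∀ q, 0 ≤ Ψ q) {q : P.left.Triple} (hq : Ψ q ≠ 0) :
    P.tripleIntegral (P.right.mom q.fst.fst) Ψ ≠ 0 := by
  have : T1Space (FibreProduct P.left.mom 𝓖.r) := (LeftAction.locallyT2_pair hG P.left).t1Space
  have hfib := 𝓖.t2Space_fiber hG
  have h1 := P.left.integral_triple_mem_Cc (chi := chi) hG hΨ
  have h2 := P.left.integral_pair_mem_Cc (chi := chi) hG h1
  have hp1 := integral_slice_pos chi.continuousFamily chi.fullSupport hfib hΨ h0 hq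
  have hp2 := integral_slice_pos chi.continuousFamily chi.fullSupport hfib h1
    (fun p => integral_nonneg fun _ => h0 _) hp1
  exact (integral_fiber_pos P.continuousFamily P.fullSupport
    (mem_Cc_comp_isClosedEmbedding h2 (isClosedEmbedding_fiber P.right.continuous_mom _))
    (fun x => integral_nonneg fun _ => integral_nonneg fun _ => h0 _)
    (t := ⟨q.fst.fst, rfl⟩) hp2).ne'

/-- Both sides of the braid relation transform the triple integral by a density; the two densities
agree because the measures have full support. -/
theorem TopCorrespondence.weight_cocycle (hC : T2Space C) (q : P.left.Triple) :
    P.weight (P.left.tripleSwap q).fst =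
      P.weight (P.left.tripleSwap (P.left.tripleInv q)).fst * P.weight q.fst := by
  set θ₁ := P.left.tripleInv
  set θ₂ := P.left.tripleSwap
  set w : P.left.Triple → ℝ := fun q => P.weight q.fst
  have hw : Continuous w := P.continuous_weight.comp FibreProduct.continuous_fst
  have h11 : ∀ q, θ₁ (θ₁ q) = q := P.left.tripleInv_tripleInv
  have h22 : ∀ q, θ₂ (θ₂ q) = q := fun q => rfl
  have hbraid : ∀ q, θ₁ (θ₂ (θ₁ q)) = θ₂ (θ₁ (θ₂ q)) := P.left.triple_braid
  set E : P.left.Triple → ℝ := fun q => w (θ₂ q) - w (θ₂ (θ₁ q)) * w q with hE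
  have hEc : Continuous E := (hw.comp θ₂.continuous).sub
    ((hw.comp (θ₂.continuous.comp θ₁.continuous)).mul hw)
  have key : ∀ c, ∀ Ψ ∈ Cc P.left.Triple, P.tripleIntegral c (fun q => Ψ q * E q) = 0 := by
    intro c Ψ hΨ
    have hcomp : ∀ (θ : P.left.Triple ≃ₜ P.left.Triple) {f : P.left.Triple → ℝ},
        f ∈ Cc _ → (fun q => f (θ q)) ∈ Cc _ := fun θ f hf =>
      mem_Cc_comp_isClosedEmbedding hf θ.isClosedEmbedding
    -- The triple integral of `Ψ ∘ θ₁ ∘ θ₂ ∘ θ₁ = Ψ ∘ θ₂ ∘ θ₁ ∘ θ₂` is computed in two ways.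
    have hΨ₀ := hcomp θ₁ (hcomp θ₂ (hcomp θ₁ hΨ))
    have e1 : P.tripleIntegral c (fun q => Ψ (θ₁ (θ₂ (θ₁ q)))) =
        P.tripleIntegral c fun q => Ψ q * (w (θ₂ (θ₁ q)) * w q) := by
      have a1 := hcomp θ₁ hΨ₀
      have a2 := mem_Cc_mul_continuous a1 hw
      rw [P.tripleIntegral_inv hG c hΨ₀, P.tripleIntegral_swap hG c a2,
        P.tripleIntegral_inv hG c (hcomp θ₂ a2)]
      refine congrArg _ (funext fun q => ?_)
      change Ψ (θ₁ (θ₂ (θ₁ (θ₁ (θ₂ (θ₁ q)))))) * w (θ₂ (θ₁ q)) * w q = _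
      rw [h11, h22, h11, mul_assoc]
    have e2 : P.tripleIntegral c (fun q => Ψ (θ₁ (θ₂ (θ₁ q)))) =
        P.tripleIntegral c fun q => Ψ q * w (θ₂ q) := by
      have a1 := hcomp θ₂ hΨ₀
      have a2 := mem_Cc_mul_continuous (hcomp θ₁ a1) hw
      rw [P.tripleIntegral_swap hG c hΨ₀, P.tripleIntegral_inv hG c a1,
        P.tripleIntegral_swap hG c a2]
      refine congrArg _ (funext fun q => ?_)
      change Ψ (θ₁ (θ₂ (θ₁ (θ₂ (θ₁ (θ₂ q)))))) * w (θ₂ q) = _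
      rw [hbraid, h22, h11, h22]
    have e3 := P.tripleIntegral_sub hG c hC
      (mem_Cc_mul_continuous hΨ (hw.comp θ₂.continuous))
      (mem_Cc_mul_continuous hΨ ((hw.comp (θ₂.continuous.comp θ₁.continuous)).mul hw))
    simp only [Function.comp_apply, Pi.mul_apply] at e3
    rw [← e1, e2, sub_self] at e3
    rw [← e3]
    refine congrArg _ (funext fun q => ?_)
    simp only [hE]
    ring
  -- With `ψ` a bump function at `q`, the function `ψ E²` is nonnegative and has integral zero.
  by_contra hne
  have hEq : E q ≠ 0 := sub_ne_zero.2 hne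
  have hT : LocallyT2 P.left.Triple :=
    FibreProduct.locallyT2 (LeftAction.locallyT2_pair hG P.left) hG
  have : LocallyCompactSpace (FibreProduct P.left.mom 𝓖.r) :=
    FibreProduct.locallyCompactSpace P.left.continuous_mom 𝓖.continuous_r
  have : LocallyCompactSpace P.left.Triple := FibreProduct.locallyCompactSpace
    (P.left.continuous_mom.comp FibreProduct.continuous_fst) 𝓖.continuous_r
  obtain ⟨U, -, hU, hUT, -, ψ, hψ, hψ0, hψ1⟩ := exists_mem_Cc_pos hT isOpen_univ (Set.mem_univ q)
  have hψE := mem_Cc_mul_continuous (hψ.mem_Cc hU hUT) hEc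
  refine P.tripleIntegral_ne_zero hG hC (mem_Cc_mul_continuous hψE hEc) (fun q => ?_)
    (q := q) ?_ (key _ _ hψE)
  · rw [mul_assoc]
    exact mul_nonneg (hψ0 q) (mul_self_nonneg _)
  · simp [hψ1, hEq]

/-- The adjoining function is multiplicative. -/
theorem TopCorrespondence.adj_mul (hC : T2Space C) (g h : G) (x : X) (e : 𝓖.s g = 𝓖.r h)
    (e' : 𝓖.s h = P.left.mom x) :
    P.adj (FibreProduct.mk (𝓖.mul g h e) x ((𝓖.s_mul _ _ _).trans e')) =
      P.adj (FibreProduct.mk g (P.left.act h x e') (e.trans (P.left.mom_act _ _ _).symm)) *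
        P.adj (FibreProduct.mk h x e') := by
  have hm : P.left.mom (P.left.act (𝓖.mul g h e) x ((𝓖.s_mul _ _ _).trans e')) = 𝓖.r g :=
    (P.left.mom_act _ _ _).trans (𝓖.r_mul _ _ _)
  have h1 := P.weight_cocycle hG hC (FibreProduct.mk (FibreProduct.mk
    (P.left.act (𝓖.mul g h e) x ((𝓖.s_mul _ _ _).trans e')) g hm) (𝓖.mul g h e)
      (P.left.mom_act _ _ _))
  have hgx : P.left.act (𝓖.inv g) (P.left.act (𝓖.mul g h e) x ((𝓖.s_mul _ _ _).trans e'))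
      ((𝓖.s_inv _).trans hm.symm) = P.left.act h x e' := by
    refine (P.left.act_congr rfl (P.left.mul_act g h x e e') _ ((𝓖.s_inv g).trans
      (P.left.mom_act _ _ _).symm)).trans ?_
    exact P.left.inv_act _ _ _
  have hgh := 𝓖.inv_mul_cancel_left g h e
  have a1 : P.adj (FibreProduct.mk (𝓖.mul g h e) x ((𝓖.s_mul _ _ _).trans e')) =
      P.weight (P.left.tripleSwap (FibreProduct.mk (FibreProduct.mk
        (P.left.act (𝓖.mul g h e) x ((𝓖.s_mul _ _ _).trans e')) g hm) (𝓖.mul g h e)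
        (P.left.mom_act _ _ _))).fst :=
    congrArg P.adj (FibreProduct.ext' rfl (P.left.inv_act _ _ _).symm)
  have a2 : P.adj (FibreProduct.mk g (P.left.act h x e') (e.trans (P.left.mom_act _ _ _).symm)) =
      P.weight (FibreProduct.mk
        (P.left.act (𝓖.mul g h e) x ((𝓖.s_mul _ _ _).trans e')) g hm) :=
    congrArg P.adj (FibreProduct.ext' rfl hgx.symm)
  rw [a1, h1, a2, mul_comm]
  refine congrArg _ (congrArg P.adj (FibreProduct.ext' hgh ?_))
  refine (P.left.act_congr (congrArg 𝓖.inv hgh) hgx _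
    ((𝓖.s_inv _).trans (P.left.mom_act _ _ _).symm)).trans ?_
  exact P.left.inv_act _ _ _

end

end Cocycle

/-! ### The composite measure -/

/-- Exchange of the two factors of a fibre product. -/
def FibreProduct.swap {X Y B : Type*} [TopologicalSpace X] [TopologicalSpace Y] (f : X → B)
    (g : Y → B) : FibreProduct f g ≃ₜ FibreProduct g f where
  toFun p := FibreProduct.mk p.snd p.fst p.w.symm
  invFun p := FibreProduct.mk p.snd p.fst p.w.symm
  left_inv _ := rfl
  right_inv _ := rfl
  continuous_toFun :=
    FibreProduct.continuous_mk FibreProduct.continuous_snd FibreProduct.continuous_fst _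
  continuous_invFun :=
    FibreProduct.continuous_mk FibreProduct.continuous_snd FibreProduct.continuous_fst _

section Composite

variable {B₁ G₁ B₂ G₂ B₃ G₃ X Y : Type*}
  [TopologicalSpace B₁] [TopologicalSpace G₁] [TopologicalSpace B₂] [TopologicalSpace G₂]
  [TopologicalSpace B₃] [TopologicalSpace G₃] [TopologicalSpace X] [TopologicalSpace Y]
  [MeasurableSpace G₁] [MeasurableSpace G₂] [MeasurableSpace G₃]
  [MeasurableSpace X] [MeasurableSpace Y]
  {𝓖₁ : TopGroupoid B₁ G₁} {𝓖₂ : TopGroupoid B₂ G₂} {𝓖₃ : TopGroupoid B₃ G₃}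
  {chi₁ : HaarSystem 𝓖₁} {chi₂ : HaarSystem 𝓖₂} {chi₃ : HaarSystem 𝓖₃}
  (P : TopCorrespondence chi₁ chi₂ X) (Q : TopCorrespondence chi₂ chi₃ Y)

theorem continuous_compositeCocycle : Continuous (compositeCocycle P Q) :=
  Q.adj_continuous.comp (FibreProduct.continuous_mk
    (𝓖₂.continuous_inv.comp FibreProduct.continuous_snd)
    (FibreProduct.continuous_snd.comp FibreProduct.continuous_fst) _)

variable [BorelSpace X] [T2Space X] [T2Space Y]

theorem integrable_composite_inner {f : CompositeSpace P Q → ℝ} (hf : f ∈ Cc (CompositeSpace P Q))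
    (y : Y) : Integrable (fun x : {x : X // P.right.mom x = Q.left.mom y} =>
      f (FibreProduct.mk x.1 y x.2)) (P.lam (Q.left.mom y)) :=
  integrable_slice P.continuousFamily (fun _ => inferInstance)
    (mem_Cc_comp_isClosedEmbedding hf (FibreProduct.swap Q.left.mom P.right.mom).isClosedEmbedding) y

variable [LocallyCompactSpace X] [LocallyCompactSpace Y] [T2Space B₂]

theorem composite_inner_mem_Cc {f : CompositeSpace P Q → ℝ} (hf : f ∈ Cc (CompositeSpace P Q)) :
    (fun y => ∫ x, f (FibreProduct.mk x.1 y x.2) ∂P.lam (Q.left.mom y)) ∈ Cc Y :=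
  mem_Cc_integral_fiber .of_t2Space .of_t2Space P.right.continuous_mom P.continuousFamily
    (fun _ => inferInstance) Q.left.continuous_mom
    (mem_Cc_comp_isClosedEmbedding hf (FibreProduct.swap Q.left.mom P.right.mom).isClosedEmbedding)

theorem integrable_composite_outer [BorelSpace Y] [T2Space B₃] {f : CompositeSpace P Q → ℝ}
    (hf : f ∈ Cc (CompositeSpace P Q)) (u : B₃) :
    Integrable (fun y : {y : Y // Q.right.mom y = u} =>
      ∫ x, f (FibreProduct.mk x.1 y.1 x.2) ∂P.lam (Q.left.mom y.1)) (Q.lam u) :=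
  Q.continuousFamily.integrable u (mem_Cc_comp_isClosedEmbedding (composite_inner_mem_Cc P Q hf)
    (isClosedEmbedding_fiber Q.right.continuous_mom u))

/-- The iterated integral is a positive linear functional on `C_c`, hence given by exactly one
Radon measure. -/
theorem existsUnique_isCompositeMeasure [BorelSpace Y] [T2Space B₃] (u : B₃) :
    ∃! m : Measure (CompositeSpace P Q), IsCompositeMeasure P Q u m := by
  have : LocallyCompactSpace (CompositeSpace P Q) :=
    FibreProduct.locallyCompactSpace P.right.continuous_mom Q.left.continuous_mom
  have hCc : ∀ f : CompactlySupportedContinuousMap (CompositeSpace P Q) ℝ,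
      (f : CompositeSpace P Q → ℝ) ∈ Cc (CompositeSpace P Q) := fun f =>
    (mem_Cc_iff _).2 ⟨f.continuous, f.hasCompactSupport⟩
  let Λ : CompactlySupportedContinuousMap (CompositeSpace P Q) ℝ →ₚ[ℝ] ℝ :=
    PositiveLinearMap.mk₀
      { toFun := fun f => ∫ y, ∫ x, f (FibreProduct.mk x.1 y.1 x.2)
          ∂(P.lam (Q.left.mom y.1)) ∂(Q.lam u)
        map_add' := fun f g => by
          rw [← integral_add (integrable_composite_outer P Q (hCc f) u)
            (integrable_composite_outer P Q (hCc g) u)]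
          refine integral_congr_ae (.of_forall fun y => ?_)
          exact integral_add (integrable_composite_inner P Q (hCc f) y.1)
            (integrable_composite_inner P Q (hCc g) y.1)
        map_smul' := fun a f => by
          simp only [CompactlySupportedContinuousMap.coe_smul, Pi.smul_apply, smul_eq_mul,
            integral_const_mul, RingHom.id_apply] }
      fun f hf => integral_nonneg fun y => integral_nonneg fun x => hf _
  refine ⟨RealRMK.rieszMeasure Λ, ⟨inferInstance, fun f hf => ?_⟩, fun m hm => ?_⟩
  · obtain ⟨hc, hs⟩ := (mem_Cc_iff _).1 hf
    exact RealRMK.integral_rieszMeasure Λ ⟨⟨f, hc⟩, hs⟩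
  · have := hm.regular
    refine Measure.ext_of_integral_eq_on_compactlySupported fun f => ?_
    rw [hm.integral_eq _ (hCc f), RealRMK.integral_rieszMeasure]
    rfl

/-! ### Quasi-invariance of the composite measure -/

variable [BorelSpace G₂] [LocallyCompactSpace G₂]

/-- Integration over `Z ⋊ G₂` as an iterated integral in which the variable of `X` is integrated
first. -/
theorem IsCompositeMeasure.integral_integral (hG : LocallyT2 G₂) {u : B₃}
    {m : Measure (CompositeSpace P Q)} (hm : IsCompositeMeasure P Q u m)
    {f : FibreProduct (compositeAction P Q).mom 𝓖₂.r → ℝ}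
    (hf : f ∈ Cc (FibreProduct (compositeAction P Q).mom 𝓖₂.r)) :
    ∫ z, ∫ p, f p.1 ∂((compositeAction P Q).inducedHaar chi₂ z) ∂m =
      ∫ y, ∫ g, ∫ x, f (FibreProduct.mk (FibreProduct.mk x.1 y.1 x.2) g.1 (x.2.trans g.2.symm))
        ∂P.lam (Q.left.mom y.1) ∂chi₂.measure (Q.left.mom y.1) ∂Q.lam u := by
  have : LocallyCompactSpace (CompositeSpace P Q) :=
    FibreProduct.locallyCompactSpace P.right.continuous_mom Q.left.continuous_mom
  simp_rw [RightAction.integral_inducedHaar]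
  rw [hm.integral_eq _ (mem_Cc_integral_fiber .of_t2Space hG 𝓖₂.continuous_r
    chi₂.continuousFamily (𝓖₂.t2Space_fiber hG) (compositeAction P Q).continuous_mom hf)]
  refine integral_congr_ae (.of_forall fun y => ?_)
  have := 𝓖₂.t2Space_fiber hG (Q.left.mom y.1)
  have := chi₂.continuousFamily.regular (Q.left.mom y.1)
  have := P.continuousFamily.regular (Q.left.mom y.1)
  let j : {x : X // P.right.mom x = Q.left.mom y.1} × {g : G₂ // 𝓖₂.r g = Q.left.mom y.1} →
      FibreProduct (compositeAction P Q).mom 𝓖₂.r := fun q =>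
    FibreProduct.mk (FibreProduct.mk q.1.1 y.1 q.1.2) q.2.1 (q.1.2.trans q.2.2.symm)
  have hcont : Continuous j :=
    FibreProduct.continuous_mk (FibreProduct.continuous_mk
      (continuous_subtype_val.comp continuous_fst) continuous_const _)
      (continuous_subtype_val.comp continuous_snd) _
  have hj : IsClosedEmbedding j := by
    refine ⟨IsEmbedding.of_comp hcont
      (g := fun p : FibreProduct (compositeAction P Q).mom 𝓖₂.r => (p.fst.fst, p.snd))
      ((FibreProduct.continuous_fst.comp FibreProduct.continuous_fst).prodMk
        FibreProduct.continuous_snd) (IsEmbedding.subtypeVal.prodMap IsEmbedding.subtypeVal), ?_⟩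
    convert (isClosed_singleton (x := y.1)).preimage
      ((FibreProduct.continuous_snd.comp FibreProduct.continuous_fst :
        Continuous fun p : FibreProduct (compositeAction P Q).mom 𝓖₂.r => p.fst.snd)) using 1
    ext p
    constructor
    · rintro ⟨t, rfl⟩
      rfl
    · intro hp
      have hp' : p.fst.snd = y.1 := hp
      have hx : P.right.mom p.fst.fst = Q.left.mom y.1 :=
        p.fst.w.trans (congrArg Q.left.mom hp')
      exact ⟨(⟨p.fst.fst, hx⟩, ⟨p.snd, p.w.symm.trans hx⟩),
        FibreProduct.ext' (FibreProduct.ext' rfl hp'.symm) rfl⟩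
  have hswap := integral_integral_swap_of_mem_Cc (μ := P.lam (Q.left.mom y.1))
    (ν := chi₂.measure (Q.left.mom y.1)) (mem_Cc_comp_isClosedEmbedding hf hj)
  refine Eq.trans (integral_congr_ae (.of_forall fun x => ?_)) hswap
  -- The two inner integrals are over the fibres at the equal points `s_X(x)` and `r_Y(y)`.
  have transport : ∀ {b b' : B₂} (_ : b = b') (F : ∀ g : G₂, 𝓖₂.r g = b → ℝ)
      (F' : ∀ g : G₂, 𝓖₂.r g = b' → ℝ) (_ : ∀ g h h', F g h = F' g h'),
      ∫ g, F g.1 g.2 ∂chi₂.measure b = ∫ g, F' g.1 g.2 ∂chi₂.measure b' := by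
    rintro b _ rfl F F' h
    exact integral_congr_ae (.of_forall fun g => h _ _ _)
  exact transport (x.2 : P.right.mom x.1 = Q.left.mom y.1)
    (fun g hg => f (FibreProduct.mk (FibreProduct.mk x.1 y.1 x.2) g hg.symm))
    (fun g hg => f (FibreProduct.mk (FibreProduct.mk x.1 y.1 x.2) g (x.2.trans hg.symm)))
    fun _ _ _ => rfl

/-- The composite measure is strongly quasi-invariant. With the variable of `X` integrated out first, a
test function on `Z ⋊ G₂` becomes one on `Y ⋊ G₂`, to which the adjoining relation of `Q` applies;
invariance of the measures on `X` takes care of the coordinate of `X`. -/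
theorem IsCompositeMeasure.isStronglyQuasiInvariant [BorelSpace Y] [T2Space B₃]
    (hG : LocallyT2 G₂) {u : B₃}
    {m : Measure (CompositeSpace P Q)} (hm : IsCompositeMeasure P Q u m) :
    (compositeAction P Q).transformation.IsStronglyQuasiInvariant
      ((compositeAction P Q).inducedHaar chi₂) m (compositeCocycle P Q) where
  continuous := continuous_compositeCocycle P Q
  pos _ := Q.adj_pos _
  map_mul p q e := by
    have hpq : 𝓖₂.s p.snd = 𝓖₂.r q.snd := ((compositeAction P Q).mom_act _ _ p.w).symm.trans
      ((congrArg (compositeAction P Q).mom e).trans q.w)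
    have hq : Q.left.act (𝓖₂.inv p.snd) p.fst.snd
        (((𝓖₂.s_inv p.snd).trans p.w.symm).trans p.fst.w) = q.fst.snd :=
      congrArg FibreProduct.snd e
    have h1 := Q.adj_mul hG inferInstance (𝓖₂.inv q.snd) (𝓖₂.inv p.snd) p.fst.snd
      ((𝓖₂.s_inv _).trans (hpq.symm.trans (𝓖₂.r_inv _).symm))
      (((𝓖₂.s_inv p.snd).trans p.w.symm).trans p.fst.w)
    refine Eq.trans (congrArg Q.adj ?_) (h1.trans ?_)
    · exact FibreProduct.ext' (𝓖₂.inv_mul_rev _ _ hpq) rfl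
    · rw [mul_comm]
      exact congrArg _ (congrArg Q.adj (FibreProduct.ext' rfl hq))
  quasiInvariant f hf := by
    have : LocallyCompactSpace (FibreProduct Q.left.mom 𝓖₂.r) :=
      FibreProduct.locallyCompactSpace Q.left.continuous_mom 𝓖₂.continuous_r
    have hf' := mem_Cc_comp_isClosedEmbedding
      (mem_Cc_mul_continuous hf (continuous_compositeCocycle P Q))
      (compositeAction P Q).transformation.invHomeomorph.isClosedEmbedding
    refine (hm.integral_integral P Q hG hf).trans
      (Eq.trans ?_ (hm.integral_integral P Q hG hf').symm)
    let E : FibreProduct (fun p : FibreProduct Q.left.mom 𝓖₂.r => Q.left.mom p.fst) P.right.mom ≃ₜ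
        FibreProduct (compositeAction P Q).mom 𝓖₂.r :=
      { toFun := fun q => FibreProduct.mk (FibreProduct.mk q.snd q.fst.fst q.w.symm) q.fst.snd
          (q.w.symm.trans q.fst.w)
        invFun := fun p => FibreProduct.mk (FibreProduct.mk p.fst.snd p.snd
          (p.fst.w.symm.trans p.w)) p.fst.fst p.fst.w.symm
        left_inv := fun _ => rfl
        right_inv := fun _ => rfl
        continuous_toFun := FibreProduct.continuous_mk (FibreProduct.continuous_mk
          FibreProduct.continuous_snd
          (FibreProduct.continuous_fst.comp FibreProduct.continuous_fst) _)
          (FibreProduct.continuous_snd.comp FibreProduct.continuous_fst) _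
        continuous_invFun := FibreProduct.continuous_mk (FibreProduct.continuous_mk
          (FibreProduct.continuous_snd.comp FibreProduct.continuous_fst)
          FibreProduct.continuous_snd _)
          (FibreProduct.continuous_fst.comp FibreProduct.continuous_fst) _ }
    have hfE := mem_Cc_comp_isClosedEmbedding hf E.isClosedEmbedding
    have hpair := LeftAction.locallyT2_pair hG Q.left
    have : T1Space (FibreProduct Q.left.mom 𝓖₂.r) := hpair.t1Space
    -- Integrate out the variable of `X`.
    have hΦ := mem_Cc_integral_fiber hpair .of_t2Space P.right.continuous_mom P.continuousFamily
      (fun _ => inferInstance) (Q.left.continuous_mom.comp FibreProduct.continuous_fst) hfE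
    refine (Q.integral_inv u hΦ).trans ?_
    refine integral_congr_ae (.of_forall fun y => integral_congr_ae (.of_forall fun g => ?_))
    have hc := ((mem_Cc_iff _).1 (mem_Cc_comp_isClosedEmbedding hfE
      (FibreProduct.isClosedEmbedding_slice (Q.left.pairInv
        (FibreProduct.mk y.1 g.1 g.2.symm))))).1
    have htr := P.integral_translate g.1 (c := Q.left.mom y.1)
      (c' := Q.left.mom (Q.left.pairInv (FibreProduct.mk y.1 g.1 g.2.symm)).fst) g.2
      ((Q.left.mom_act _ _ _).trans (𝓖₂.r_inv _)).symm hc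
    refine (congrArg (· * _) htr).trans ((integral_mul_const _ _).symm.trans ?_)
    refine integral_congr_ae (.of_forall fun x => ?_)
    refine congrArg₂ (· * ·) rfl (congrArg Q.adj (FibreProduct.ext' ?_ rfl))
    exact (𝓖₂.inv_inv _).symm

end Composite

/-- A function `b` that transforms by the cocycle of `m` turns `m` into the invariant measure
`b m`. -/
theorem TopGroupoid.IsStronglyQuasiInvariant.isInvariantMeasure {B G : Type*} [TopologicalSpace B]
    [TopologicalSpace G] [MeasurableSpace B] [BorelSpace B] [MeasurableSpace G]
    {𝓖 : TopGroupoid B G} {lam : ∀ b, Measure {g : G // 𝓖.r g = b}} {m : Measure B} {Δ : G → ℝ}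
    (h : 𝓖.IsStronglyQuasiInvariant lam m Δ) {b : B → ℝ} (hb : Continuous b) (hb0 : ∀ v, 0 < b v)
    (hbΔ : ∀ g, b (𝓖.s g) = Δ g * b (𝓖.r g)) :
    𝓖.IsInvariantMeasure lam (m.withDensity fun v => ENNReal.ofReal (b v)) := by
  intro f hf
  have hdens : ∀ k : B → ℝ, ∫ v, k v ∂(m.withDensity fun v => ENNReal.ofReal (b v)) =
      ∫ v, b v * k v ∂m := by
    intro k
    refine (integral_withDensity_eq_integral_smul (f := fun v => (b v).toNNReal)
      hb.measurable.real_toNNReal k).trans ?_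
    refine integral_congr_ae (.of_forall fun v => ?_)
    simp [NNReal.smul_def, Real.coe_toNNReal _ (hb0 v).le]
  rw [hdens, hdens]
  have key := h.quasiInvariant _ (mem_Cc_mul_continuous hf (hb.comp 𝓖.continuous_r))
  refine Eq.trans ?_ (key.trans ?_)
  · refine integral_congr_ae (.of_forall fun v => ?_)
    refine (integral_const_mul _ _).symm.trans (integral_congr_ae (.of_forall fun g => ?_))
    simp only [Function.comp_apply, g.2]
    ring
  · refine integral_congr_ae (.of_forall fun v => ?_)
    refine Eq.trans (integral_congr_ae (.of_forall fun g => ?_)) (integral_const_mul _ _)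
    have h1 := hbΔ (𝓖.inv g.1)
    rw [𝓖.s_inv, g.2] at h1
    simp only [Function.comp_apply, h1]
    ring

/-! ### Cocycles on proper groupoids -/

section ProperGroupoid

variable {Z T Ω : Type*} [TopologicalSpace Z] [TopologicalSpace T] [TopologicalSpace Ω]
  (𝓣 : TopGroupoid Z T) {Δ : T → ℝ}

theorem TopGroupoid.cocycle_mul_inv (hΔ0 : ∀ p, 0 < Δ p)
    (hΔm : ∀ p q (e : 𝓣.s p = 𝓣.r q), Δ (𝓣.mul p q e) = Δ p * Δ q) (p : T) :
    Δ p * Δ (𝓣.inv p) = 1 := by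
  have h1 : Δ (𝓣.unit (𝓣.r p)) = 1 := by
    have := hΔm (𝓣.unit (𝓣.r p)) p (𝓣.s_unit _)
    rw [𝓣.unit_mul] at this
    exact mul_right_cancel₀ (hΔ0 p).ne' (by rw [one_mul, ← this])
  rw [← hΔm p (𝓣.inv p) (𝓣.r_inv _).symm, 𝓣.mul_inv, h1]

/-- Let `e ≥ 0` be a bump function. The supremum of `e(s p) / Δ(p)` over all arrows `p` with
`r p = z` is a continuous function of `z` that transforms by `Δ`: it is lower semicontinuous because
`r` is open, and upper semicontinuous because the groupoid is proper. -/
theorem TopGroupoid.exists_local_density [T2Space Z] [LocallyCompactSpace Z]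
    (hr : IsOpenMap 𝓣.r) (hp : IsProperMap fun p => (𝓣.r p, 𝓣.s p)) (hΔ : Continuous Δ)
    (hΔ0 : ∀ p, 0 < Δ p) (hΔm : ∀ p q (e : 𝓣.s p = 𝓣.r q), Δ (𝓣.mul p q e) = Δ p * Δ q)
    (z₀ : Z) : ∃ b : Z → ℝ, Continuous b ∧ (∀ z, 0 ≤ b z) ∧ 0 < b z₀ ∧
      ∀ p, b (𝓣.s p) = Δ p * b (𝓣.r p) := by
  obtain ⟨e, he1, -, hec, he⟩ := exists_continuous_one_zero_of_isCompact
    (isCompact_singleton (x := z₀)) isClosed_empty (Set.disjoint_empty _)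
  set K := tsupport e with hK
  have hKc : IsCompact K := hec
  have heK : ∀ z ∉ K, e z = 0 := fun z hz => image_eq_zero_of_notMem_tsupport hz
  set h : T → ℝ := fun p => e (𝓣.s p) / Δ p with hh
  have hhc : Continuous h :=
    (e.continuous.comp 𝓣.continuous_s).div hΔ fun p => (hΔ0 p).ne'
  have hh0 : ∀ p, 0 ≤ h p := fun p => div_nonneg (he _).1 (hΔ0 p).le
  set b : Z → ℝ := fun z => ⨆ p : {p : T // 𝓣.r p = z}, h p with hb
  have hne : ∀ z, Nonempty {p : T // 𝓣.r p = z} := fun z => ⟨⟨𝓣.unit z, 𝓣.r_unit z⟩⟩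
  have hbdd : ∀ z, BddAbove (Set.range fun p : {p : T // 𝓣.r p = z} => h p) := by
    intro z
    have hc : IsCompact ((fun p => (𝓣.r p, 𝓣.s p)) ⁻¹' ({z} ×ˢ K)) :=
      hp.isCompact_preimage (isCompact_singleton.prod hKc)
    obtain ⟨M, hM⟩ := (hc.image hhc).bddAbove
    refine ⟨max M 0, ?_⟩
    rintro _ ⟨p, rfl⟩
    by_cases hpK : 𝓣.s p.1 ∈ K
    · exact (hM ⟨p.1, ⟨p.2, hpK⟩, rfl⟩).trans (le_max_left _ _)
    · simp [hh, heK _ hpK]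
  have hle : ∀ p, h p ≤ b (𝓣.r p) := fun p =>
    le_ciSup (f := fun p : {q : T // 𝓣.r q = 𝓣.r p} => h p) (hbdd _) ⟨p, rfl⟩
  have hb0 : ∀ z, 0 ≤ b z := fun z => Real.iSup_nonneg fun p => hh0 _
  have hineq : ∀ p, b (𝓣.s p) ≤ Δ p * b (𝓣.r p) := by
    intro p
    refine ciSup_le fun q => ?_
    have hm : h q.1 = Δ p * h (𝓣.mul p q.1 q.2.symm) := by
      simp only [hh, hΔm, 𝓣.s_mul]
      have := (hΔ0 p).ne'
      have := (hΔ0 q.1).ne'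
      field_simp
    rw [hm]
    refine mul_le_mul_of_nonneg_left ?_ (hΔ0 p).le
    rw [← 𝓣.r_mul p q.1 q.2.symm]
    exact hle _
  refine ⟨b, ?_, hb0, ?_, fun p => le_antisymm (hineq p) ?_⟩
  · rw [continuous_iff_continuousAt]
    intro z
    refine tendsto_order.2 ⟨fun a ha => ?_, fun a ha => ?_⟩
    · -- Lower semicontinuity.
      obtain ⟨p, hpa⟩ := exists_lt_of_lt_ciSup ha
      have hop : IsOpen (𝓣.r '' {q | a < h q}) := hr _ (isOpen_lt continuous_const hhc)
      filter_upwards [hop.mem_nhds ⟨p.1, hpa, p.2⟩]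
      rintro _ ⟨q, hq, rfl⟩
      exact lt_of_lt_of_le hq (hle q)
    · -- Upper semicontinuity: `{a' ≤ h}` has closed image in `Z × Z`, and this image lies over the
      -- compact set `K` in the second coordinate, so it misses a whole tube around `{z} × K`.
      obtain ⟨a', ha', haa'⟩ := exists_between ha
      have ha'0 : 0 < a' := (hb0 z).trans_lt ha'
      have hD : IsClosed ((fun p => (𝓣.r p, 𝓣.s p)) '' {q | a' ≤ h q}) :=
        hp.isClosedMap _ (isClosed_le continuous_const hhc)
      have hev : ∀ᶠ z' in 𝓝 z, ∀ k ∈ K,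
          (z', k) ∉ (fun p => (𝓣.r p, 𝓣.s p)) '' {q | a' ≤ h q} := by
        refine hKc.eventually_forall_of_forall_eventually fun k _ => ?_
        refine hD.isOpen_compl.mem_nhds ?_
        rintro ⟨q, hq, hqz⟩
        have hqr : 𝓣.r q = z := congrArg Prod.fst hqz
        exact (hq.trans (hle q)).not_gt (hqr ▸ ha')
      filter_upwards [hev] with z' hz'
      refine lt_of_le_of_lt (ciSup_le fun p => ?_) haa'
      by_contra hcon
      have hpa := (not_le.1 hcon).le
      have hpK : 𝓣.s p.1 ∈ K := by
        by_contra hpK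
        have : h p.1 = 0 := by simp [hh, heK _ hpK]
        exact ha'0.not_ge (this ▸ hpa)
      exact hz' _ hpK ⟨p.1, hpa, Prod.ext p.2 rfl⟩
  · have h1 := hle (𝓣.unit z₀)
    rw [𝓣.r_unit] at h1
    refine lt_of_lt_of_le ?_ h1
    have h2 : e z₀ = 1 := he1 rfl
    simp only [hh, 𝓣.s_unit, h2]
    exact one_div_pos.2 (hΔ0 _)
  · have h1 := hineq (𝓣.inv p)
    rw [𝓣.s_inv, 𝓣.r_inv] at h1
    calc Δ p * b (𝓣.r p) ≤ Δ p * (Δ (𝓣.inv p) * b (𝓣.s p)) :=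
          mul_le_mul_of_nonneg_left h1 (hΔ0 p).le
      _ = b (𝓣.s p) := by
          rw [← _root_.mul_assoc, 𝓣.cocycle_mul_inv hΔ0 hΔm, one_mul]

/-- The quotient map of a groupoid with open range map onto its orbit space is open. -/
theorem TopGroupoid.isOpenQuotientMap_orbit (hr : IsOpenMap 𝓣.r) {q : Z → Ω} (hq : IsQuotientMap q)
    (hqr : ∀ z z', q z = q z' ↔ ∃ p, 𝓣.r p = z ∧ 𝓣.s p = z') : IsOpenQuotientMap q := by
  refine ⟨hq.surjective, hq.continuous, fun U hU => ?_⟩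
  rw [← hq.isOpen_preimage]
  convert hr _ (hU.preimage 𝓣.continuous_s) using 1
  ext z
  constructor
  · rintro ⟨z', hz', e⟩
    obtain ⟨p, hpr, hps⟩ := (hqr z z').1 e.symm
    exact ⟨p, show 𝓣.s p ∈ U from hps ▸ hz', hpr⟩
  · rintro ⟨p, hpU, rfl⟩
    exact ⟨𝓣.s p, hpU, ((hqr _ _).2 ⟨p, rfl, rfl⟩).symm⟩

theorem TopGroupoid.t2Space_orbit (hr : IsOpenMap 𝓣.r)
    (hp : IsProperMap fun p => (𝓣.r p, 𝓣.s p)) {q : Z → Ω} (hq : IsQuotientMap q)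
    (hqr : ∀ z z', q z = q z' ↔ ∃ p, 𝓣.r p = z ∧ 𝓣.s p = z') : T2Space Ω := by
  rw [t2Space_iff_of_isOpenQuotientMap (𝓣.isOpenQuotientMap_orbit hr hq hqr)]
  convert hp.isClosedMap.isClosed_range using 1
  ext ⟨z, z'⟩
  exact (hqr z z').trans (exists_congr fun p => by simp [Prod.ext_iff])

/-- On a proper groupoid with open range map and paracompact orbit space, every continuous cocycle
with positive values is a coboundary: the local solutions are glued by a partition of unity on the
orbit space. -/
theorem TopGroupoid.exists_density [T2Space Z] [LocallyCompactSpace Z] [ParacompactSpace Ω]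
    (hr : IsOpenMap 𝓣.r) (hp : IsProperMap fun p => (𝓣.r p, 𝓣.s p)) {q : Z → Ω}
    (hq : IsQuotientMap q) (hqr : ∀ z z', q z = q z' ↔ ∃ p, 𝓣.r p = z ∧ 𝓣.s p = z')
    (hΔ : Continuous Δ) (hΔ0 : ∀ p, 0 < Δ p)
    (hΔm : ∀ p q (e : 𝓣.s p = 𝓣.r q), Δ (𝓣.mul p q e) = Δ p * Δ q) :
    ∃ b : Z → ℝ, Continuous b ∧ (∀ z, 0 < b z) ∧ ∀ p, b (𝓣.s p) = Δ p * b (𝓣.r p) := by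
  have : T2Space Ω := 𝓣.t2Space_orbit hr hp hq hqr
  choose β hβc hβ0 hβz hβΔ using 𝓣.exists_local_density hr hp hΔ hΔ0 hΔm
  -- The sets where the local solutions are positive are saturated.
  have hpre : ∀ i, q ⁻¹' (q '' {z | 0 < β i z}) = {z | 0 < β i z} := by
    intro i
    refine Set.Subset.antisymm ?_ (Set.subset_preimage_image q _)
    rintro z ⟨z', hz', e⟩
    obtain ⟨p, rfl, rfl⟩ := (hqr z' z).1 e
    change 0 < β i _
    rw [hβΔ]
    exact mul_pos (hΔ0 p) hz'
  obtain ⟨ρ, hρ⟩ := PartitionOfUnity.exists_isSubordinate (isClosed_univ (X := Ω))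
    (fun i => q '' {z | 0 < β i z})
    (fun i => by
      rw [← hq.isOpen_preimage, hpre]
      exact isOpen_lt continuous_const (hβc i))
    (fun ω _ => by
      obtain ⟨z, rfl⟩ := hq.surjective ω
      exact Set.mem_iUnion.2 ⟨z, z, hβz z, rfl⟩)
  have hfin : ∀ z, (Function.support fun i => ρ i (q z) * β i z).Finite := fun z =>
    (ρ.locallyFinite.point_finite (q z)).subset fun i hi => left_ne_zero_of_mul hi
  refine ⟨fun z => ∑ᶠ i, ρ i (q z) * β i z, ?_, fun z => ?_, fun p => ?_⟩
  · refine continuous_finsum (fun i => ((ρ i).continuous.comp hq.continuous).mul (hβc i)) ?_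
    exact (ρ.locallyFinite.preimage_continuous hq.continuous).subset
      fun i z hz => left_ne_zero_of_mul hz
  · obtain ⟨i, hi⟩ := ρ.exists_pos (Set.mem_univ (q z))
    refine finsum_pos (fun j => mul_nonneg (ρ.nonneg j _) (hβ0 j z)) ⟨i, mul_pos hi ?_⟩ (hfin z)
    have h1 : q z ∈ q '' {z | 0 < β i z} := hρ i (subset_tsupport _ hi.ne')
    exact (hpre i).subset h1
  · have hqp : q (𝓣.s p) = q (𝓣.r p) := ((hqr _ _).2 ⟨p, rfl, rfl⟩).symm
    refine Eq.trans (finsum_congr fun i => ?_) (mul_finsum _ _).symm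
    rw [hqp, hβΔ]
    ring

end ProperGroupoid

/-! ### Proper actions and their orbit spaces -/

section Action

variable {B G X Y : Type*} [TopologicalSpace B] [TopologicalSpace G] [TopologicalSpace X]
  [TopologicalSpace Y] {𝓖 : TopGroupoid B G}

theorem FibreProduct.isOpenMap_fst {f : X → B} {g : Y → B} (hf : Continuous f)
    (hg : IsOpenMap g) : IsOpenMap (FibreProduct.fst : FibreProduct f g → X) := by
  rw [isOpenMap_iff_nhds_le]
  intro p s hs
  have hs' : FibreProduct.fst ⁻¹' s ∈ 𝓝 p := hs
  obtain ⟨W, hW, hWs⟩ := mem_nhds_subtype _ _ _ |>.1 hs'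
  obtain ⟨V, hV, U, hU, hVU⟩ := mem_nhds_prod_iff.1 hW
  have h1 : f ⁻¹' (g '' U) ∈ 𝓝 p.fst := by
    refine hf.continuousAt.preimage_mem_nhds ?_
    rw [p.w]
    exact hg.image_mem_nhds hU
  filter_upwards [hV, h1]
  rintro x hx ⟨y, hy, e⟩
  exact hWs (show (FibreProduct.mk x y e.symm : FibreProduct f g) ∈ _ from hVU ⟨hx, hy⟩)

/-- If `X` is a proper `G`-space, so is `X ×_B Y` with the diagonal action. -/
theorem RightAction.IsProper.diagonalAction [T2Space X] [T2Space Y] {R : RightAction 𝓖 X}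
    (hR : R.IsProper) (L : LeftAction 𝓖 Y) : (diagonalAction R L).IsProper := by
  unfold RightAction.IsProper at hR ⊢
  rw [isProperMap_iff_ultrafilter] at hR ⊢
  have hcont : Continuous fun p : FibreProduct (_root_.diagonalAction R L).mom 𝓖.r =>
      (p.fst, (_root_.diagonalAction R L).act p.fst p.snd p.w) :=
    FibreProduct.continuous_fst.prodMk (_root_.diagonalAction R L).continuous_act
  refine ⟨hcont, fun 𝒰 z hz => ?_⟩
  let k : FibreProduct (_root_.diagonalAction R L).mom 𝓖.r → FibreProduct R.mom 𝓖.r := fun p =>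
    FibreProduct.mk p.fst.fst p.snd p.w
  have hz1 : Filter.Tendsto (fun p : FibreProduct (_root_.diagonalAction R L).mom 𝓖.r => p.fst) 𝒰
      (𝓝 z.1) := (continuous_fst.tendsto z).comp hz
  have hz2 : Filter.Tendsto (fun p : FibreProduct (_root_.diagonalAction R L).mom 𝓖.r =>
      (_root_.diagonalAction R L).act p.fst p.snd p.w) 𝒰 (𝓝 z.2) :=
    (continuous_snd.tendsto z).comp hz
  obtain ⟨p, hp, hpU⟩ := hR.2 (𝒰 := 𝒰.map k) (y := (z.1.fst, z.2.fst))
    (((FibreProduct.continuous_fst.tendsto _).comp hz1).prodMk_nhds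
      ((FibreProduct.continuous_fst.tendsto _).comp hz2))
  have hk : Filter.Tendsto k 𝒰 (𝓝 p) := hpU
  have hp1 : p.fst = z.1.fst := congrArg Prod.fst hp
  let p' : FibreProduct (_root_.diagonalAction R L).mom 𝓖.r :=
    FibreProduct.mk z.1 p.snd ((congrArg R.mom hp1).symm.trans p.w)
  have hp' : (𝒰 : Filter _) ≤ 𝓝 p' := by
    rw [FibreProduct.isEmbedding_prod.nhds_eq_comap, ← Filter.tendsto_iff_comap]
    exact hz1.prodMk_nhds ((FibreProduct.continuous_snd.tendsto p).comp hk)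
  exact ⟨p', tendsto_nhds_unique ((hcont.tendsto p').comp hp') hz, hp'⟩

/-- The relation that defines the orbit space is an equivalence relation already. -/
theorem RightAction.quot_mk_eq_iff (R : RightAction 𝓖 X) (x x' : X) :
    (Quot.mk _ x : R.OrbitSpace) = Quot.mk _ x' ↔
      ∃ p, R.transformation.r p = x ∧ R.transformation.s p = x' := by
  have hrel : ∀ {x x'}, (∃ (g : G) (e : R.mom x = 𝓖.r g), R.act x g e = x') ↔
      ∃ p, R.transformation.r p = x ∧ R.transformation.s p = x' := by
    intro x x'
    constructor
    · rintro ⟨g, e, h⟩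
      exact ⟨FibreProduct.mk x g e, rfl, h⟩
    · rintro ⟨p, rfl, h⟩
      exact ⟨p.snd, p.w, h⟩
  have hequiv : Equivalence fun x x' =>
      ∃ p, R.transformation.r p = x ∧ R.transformation.s p = x' := by
    refine ⟨fun x => ⟨_, R.transformation.r_unit x, R.transformation.s_unit x⟩, ?_, ?_⟩
    · rintro x y ⟨p, rfl, rfl⟩
      exact ⟨_, R.transformation.r_inv p, R.transformation.s_inv p⟩
    · rintro x y z ⟨p, rfl, hp⟩ ⟨q, rfl, rfl⟩
      exact ⟨_, R.transformation.r_mul p q hp, R.transformation.s_mul p q hp⟩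
  refine ⟨fun h => ?_, fun h => Quot.sound (hrel.2 h)⟩
  have h1 := Quot.eqvGen_exact h
  simp only [hrel] at h1
  exact hequiv.eqvGen_iff.1 h1

end Action

/-! ### Existence, quasi-invariance and the invariant density -/

theorem mainTheorem6 {B₁ G₁ B₂ G₂ B₃ G₃ X Y : Type*}
    [TopologicalSpace B₁] [TopologicalSpace G₁] [MeasurableSpace G₁] [BorelSpace G₁]
    [TopologicalSpace B₂] [TopologicalSpace G₂] [MeasurableSpace G₂] [BorelSpace G₂]
    [TopologicalSpace B₃] [TopologicalSpace G₃] [MeasurableSpace G₃] [BorelSpace G₃]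
    [TopologicalSpace X] [T2Space X] [MeasurableSpace X] [BorelSpace X]
    [TopologicalSpace Y] [T2Space Y] [MeasurableSpace Y] [BorelSpace Y]
    (𝓖₁ : TopGroupoid B₁ G₁) (_h₁ : 𝓖₁.IsLocallyCompact) (chi₁ : HaarSystem 𝓖₁)
    (𝓖₂ : TopGroupoid B₂ G₂) (_h₂ : 𝓖₂.IsLocallyCompact) (chi₂ : HaarSystem 𝓖₂)
    (𝓖₃ : TopGroupoid B₃ G₃) (_h₃ : 𝓖₃.IsLocallyCompact) (chi₃ : HaarSystem 𝓖₃)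
    (P : TopCorrespondence chi₁ chi₂ X) (Q : TopCorrespondence chi₂ chi₃ Y)
    (_hΩ : (SecondCountableTopology X ∧ SecondCountableTopology Y) ∨
      ParacompactSpace (compositeAction P Q).OrbitSpace)
    (u : B₃) :
    (∃! m : Measure (CompositeSpace P Q), IsCompositeMeasure P Q u m) ∧
    ∀ m : Measure (CompositeSpace P Q), IsCompositeMeasure P Q u m →
      (compositeAction P Q).transformation.IsStronglyQuasiInvariant
        ((compositeAction P Q).inducedHaar chi₂) m (compositeCocycle P Q) ∧
      ∃ b : CompositeSpace P Q → ℝ, Continuous b ∧ (∀ z, 0 < b z) ∧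
        (compositeAction P Q).transformation.IsInvariantMeasure
          ((compositeAction P Q).inducedHaar chi₂)
          (m.withDensity fun z => ENNReal.ofReal (b z)) ∧
        ∀ (x : X) (y : Y) (g : G₂) (hxy : P.right.mom x = Q.left.mom y)
          (hxg : P.right.mom x = 𝓖₂.r g) (hgy : 𝓖₂.s (𝓖₂.inv g) = Q.left.mom y)
          (hZ : P.right.mom (P.right.act x g hxg) = Q.left.mom (Q.left.act (𝓖₂.inv g) y hgy)),
          b (FibreProduct.mk (P.right.act x g hxg) (Q.left.act (𝓖₂.inv g) y hgy) hZ) /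
              b (FibreProduct.mk x y hxy) =
            Q.adj (FibreProduct.mk (𝓖₂.inv g) y hgy) := by
  have : T2Space B₂ := _h₂.t2_units
  have : T2Space B₃ := _h₃.t2_units
  have : LocallyCompactSpace G₂ := _h₂.locallyCompact.locallyCompactSpace
  have : LocallyCompactSpace X := P.locallyCompact.locallyCompactSpace
  have : LocallyCompactSpace Y := Q.locallyCompact.locallyCompactSpace
  have hG : LocallyT2 G₂ := _h₂.locallyCompact.locallyT2
  refine ⟨existsUnique_isCompositeMeasure P Q u, fun m hm => ?_⟩
  have hqi := hm.isStronglyQuasiInvariant P Q hG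
  refine ⟨hqi, ?_⟩
  have : LocallyCompactSpace (CompositeSpace P Q) :=
    FibreProduct.locallyCompactSpace P.right.continuous_mom Q.left.continuous_mom
  have hr : IsOpenMap (compositeAction P Q).transformation.r :=
    FibreProduct.isOpenMap_fst (compositeAction P Q).continuous_mom
      (isOpenMap_of_hasFullSupport hG 𝓖₂.continuous_r chi₂.continuousFamily chi₂.fullSupport
        (𝓖₂.t2Space_fiber hG))
  have hp : IsProperMap fun p => ((compositeAction P Q).transformation.r p,
      (compositeAction P Q).transformation.s p) := P.proper.diagonalAction Q.left
  have hq : IsQuotientMap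
      (Quot.mk _ : CompositeSpace P Q → (compositeAction P Q).OrbitSpace) := isQuotientMap_quot_mk
  have hqr := (compositeAction P Q).quot_mk_eq_iff
  have hpara : ParacompactSpace (compositeAction P Q).OrbitSpace := by
    rcases _hΩ with ⟨hX, hY⟩ | h
    · have hopen := (compositeAction P Q).transformation.isOpenQuotientMap_orbit hr hq hqr
      have : SecondCountableTopology (CompositeSpace P Q) :=
        FibreProduct.isEmbedding_prod.secondCountableTopology
      have : SecondCountableTopology (compositeAction P Q).OrbitSpace :=
        hq.secondCountableTopology hopen.isOpenMap
      have : LocallyCompactSpace (compositeAction P Q).OrbitSpace := hopen.locallyCompactSpace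
      have : T2Space (compositeAction P Q).OrbitSpace :=
        (compositeAction P Q).transformation.t2Space_orbit hr hp hq hqr
      infer_instance
    · exact h
  obtain ⟨b, hb, hb0, hbΔ⟩ := (compositeAction P Q).transformation.exists_density hr hp hq hqr
    hqi.continuous hqi.pos hqi.map_mul
  refine ⟨b, hb, hb0, hqi.isInvariantMeasure hb hb0 hbΔ, fun x y g hxy hxg hgy hZ => ?_⟩
  rw [div_eq_iff (hb0 _).ne']
  exact hbΔ (FibreProduct.mk (FibreProduct.mk x y hxy) g hxg)
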